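/- **Theorem.** Let $n\ge 0$ be an integer and let $a_1,a_2,\dots,a_l$ be non-zero integers. Let $[2a_1,2a_2,\dots,2a_l]$ be the standard diagram of a $2$-bridge link: start on the left with two arcs $\subset$, one above the other, which give four horizontal strands, directed from top to bottom to the left, right, left, right; then, from left to right, put $2|a_j|$ half twists (right-handed, i.e. with the over-strand running from the upper left to the lower right, if $a_j>0$; left-handed if $a_j<0$) on the two middle strands if $j$ is odd and on the two lowest strands if $j$ is even; finally, if $l$ is odd, join the two highest strands to each other and the two lowest strands to each other, and if $l$ is even, join the two middle strands to each other and the two outer strands to each other. Let $$J_{n+1}^{\mathfrak{sl}_2}(L;q)=\bigl((-1)^nq^{\frac{n^2+2n}{4}}\bigr)^{-w(L)}\,\langle \bar L(n)\rangle_2/\langle O(n)\rangle_2\in\mathbb{Q}(q^{1/4})$$ be the colored Jones polynomial of an oriented link diagram $L$. Here $w$ is the writhe, $O$ is the circle, $\bar L(n)$ is the unoriented diagram with every strand replaced by $n$ parallel strands and one Jones–Wenzl idempotent inserted in each component, and $\langle\cdot\rangle_2$ is the Kauffman bracket with $A=q^{1/4}$ (a right-handed crossing of two horizontal strands is $q^{1/4}$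 times two horizontal strands plus $q^{-1/4}$ times $\supset\subset$; a closed loop is $-q^{1/2}-q^{-1/2}$). Then $$ J_{n+1}^{\mathfrak{sl}_2}([2a_1,\dots,2a_l];q)=\prod_{j=0}^{l-1}\ \sum_{0\le k^{(j+1)}_{|a_{j+1}|}\le\dots\le k^{(j+1)}_1\le K_j} T_{j+1}\ \times\ (-1)^{n-K_l}q^{\frac{K_l-n}{2}}\frac{1-q^{n+1}}{1-q^{K_l+1}}, $$ where the right-hand side is an iterated sum (the range of each sum, and the closing factor, depend on the outer summation variables), and $$ T_{j+1}=(-1)^{K_j-k^{(j+1)}_{|a_{j+1}|}}\,q^{\frac{\varepsilon_{j+1}}{2}\left(K_j-k^{(j+1)}_{|a_{j+1}|}\right)}\,q^{\varepsilon_{j+1}\sum_{i=1}^{|a_{j+1}|}\left((k^{(j+1)}_i)^2+k^{(j+1)}_i\right)}\, \frac{(q^{\varepsilon_{j+1}})_{K_j}}{(q^{\varepsilon_{j+1}})_{k^{(j+1)}_{|a_{j+1}|}}}\, \binom{K_j}{{k_1^{(j+1)}}',\dots,{k_{|a_{j+1}|}^{(j+1)}}',k_{|a_{j+1}|}^{(j+1)}}_{q^{\varepsilon_{j+1}}}.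 $$ Here $\varepsilon_{j}=a_{j}/|a_{j}|$, $K_0=n$, $K_{j}=n-k^{(j)}_{|a_{j}|}$ for $j\ge1$, $k^{(j+1)}_0=K_j$, ${k^{(j+1)}_{i+1}}'=k^{(j+1)}_i-k^{(j+1)}_{i+1}$, $(x)_k=\prod_{i=1}^k(1-x^i)$ and $\binom{N}{n_1,\dots,n_m}_x=\frac{(x)_N}{(x)_{n_1}\cdots(x)_{n_m}}$ for $n_1+\dots+n_m=N$. -/

import Mathlib

noncomputable section

namespace ColoredJones

/-! ## Ground field, quantum integers, `q`-Pochhammer symbols -/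

/-- The field `ℚ(q^{1/4})` of rational functions in one variable `q^{1/4}`. -/
abbrev K : Type := RatFunc ℚ

/-- The variable `q^{1/4}`. -/
def q4 : K := RatFunc.X

/-- The quantum integer `[k] = (q^{k/2} - q^{-k/2}) / (q^{1/2} - q^{-1/2})`. -/
def qInt (k : ℤ) : K := (q4 ^ (2 * k) - q4 ^ (-(2 * k))) / (q4 ^ (2 : ℤ) - q4 ^ (-2 : ℤ))

/-- The `q`-Pochhammer symbol `(x)_k = (x; x)_k = ∏_{l=1}^{k} (1 - x^l)`. -/
def poch (x : K) (k : ℕ) : K := ∏ l ∈ Finset.range k, (1 - x ^ (l + 1))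

/-- The `q`-multinomial coefficient `(x)_N / ((x)_{n_1} ⋯ (x)_{n_m})`. -/
def qMultinomial (x : K) (N : ℕ) {m : ℕ} (parts : Fin m → ℕ) : K :=
  poch x N / ∏ i, poch x (parts i)

/-! ## Partner functions

End points are numbered `0, 1, 2, …` from top to bottom on a vertical line; diagrams are read
from left to right and lie to the left of that line. An arc system with end points
`0, …, m - 1` is recorded by the map sending an end point to the other end of its arc. -/

/-- Old number to new number, when two points are inserted at positions `i`, `i + 1`. -/
def up (i j : ℕ) : ℕ := if j < i then j else j + 2

/-- Old number to new number, when the points at positions `i`, `i + 1` are removed. -/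
def down (i j : ℕ) : ℕ := if j < i then j else j - 2

theorem down_up (i j : ℕ) : down i (up i j) = j := by grind [up, down]

theorem up_down (i j : ℕ) (h : j ≠ i) (h' : j ≠ i + 1) : up i (down i j) = j := by
  grind [up, down]

/-- Insert a new arc `⊂` joining two new neighbouring end points `i`, `i + 1`. -/
def cupPartner (i : ℕ) (p : ℕ → ℕ) (j : ℕ) : ℕ :=
  if j = i then i + 1 else if j = i + 1 then i else up i (p (down i j))

/-- Join the end points `i`, `i + 1` by an arc `⊃`. (If they were already joined to each other,
this closes up a loop, which is dropped.) -/
def capPartner (i : ℕ) (p : ℕ → ℕ) (j : ℕ) : ℕ :=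
  down i (if p (up i j) = i then p (i + 1)
    else if p (up i j) = i + 1 then p i else p (up i j))

/-- Let the strands ending at `i`, `i + 1` change places. -/
def swapPartner (i : ℕ) (p : ℕ → ℕ) (j : ℕ) : ℕ :=
  Equiv.swap i (i + 1) (p (Equiv.swap i (i + 1) j))

/-! ## The `A₁` web spaces -/

/-- An `A₁` basis web on the disk with `ends` marked points: a crossingless system of arcs
without closed loops, up to isotopy, i.e. a non-crossing perfect matching of
`0, …, ends - 1`. (The partner function is the identity outside this range.) -/
@[ext]
structure BasisWeb where
  ends : ℕ
  partner : ℕ → ℕ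
  partner_lt : ∀ j, j < ends → partner j < ends
  partner_ne : ∀ j, j < ends → partner j ≠ j
  partner_partner : ∀ j, partner (partner j) = j
  partner_of_ge : ∀ j, ends ≤ j → partner j = j
  planar : ∀ i j, i < j → j < partner i → partner j < partner i

/-- The empty web. -/
def BasisWeb.empty : BasisWeb where
  ends := 0
  partner := id
  partner_lt := by simp
  partner_ne := by simp
  partner_partner := by simp
  partner_of_ge := by simp
  planar := by intro i j h₁ h₂; simp at *; omega

/-- Insert an arc `⊂` at positions `i`, `i + 1`. -/
def BasisWeb.cup (w : BasisWeb) (i : ℕ) (hi : i ≤ w.ends) : BasisWeb where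
  ends := w.ends + 2
  partner := cupPartner i w.partner
  partner_lt := by
    intro j hj
    have := w.partner_lt (down i j)
    grind [cupPartner, up, down]
  partner_ne := by
    intro j hj
    have := w.partner_ne (down i j)
    grind [cupPartner, up, down]
  partner_partner := by
    intro j
    have := w.partner_partner (down i j)
    have := down_up i (w.partner (down i j))
    have := up_down i j
    grind [cupPartner, up]
  partner_of_ge := by
    intro j hj
    have := w.partner_of_ge (down i j)
    grind [cupPartner, up, down]
  planar := by
    intro a b h₁ h₂
    have := w.planar (down i a) (down i b)
    have := w.partner_partner (down i b)
    grind [cupPartner, up, down]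

/-- Join the end points `i`, `i + 1` by an arc `⊃`. -/
def BasisWeb.cap (w : BasisWeb) (i : ℕ) (hi : i + 2 ≤ w.ends) : BasisWeb where
  ends := w.ends - 2
  partner := capPartner i w.partner
  partner_lt := by
    intro j hj
    have := w.partner_lt (up i j)
    have := w.partner_partner (up i j)
    have := w.partner_lt i
    have := w.partner_lt (i + 1)
    have := w.partner_ne i
    have := w.partner_ne (i + 1)
    grind [capPartner, up, down]
  partner_ne := by
    intro j hj
    have := w.partner_ne (up i j)
    have := w.partner_partner (up i j)
    have := w.partner_partner i
    have := w.partner_partner (i + 1)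
    have := w.partner_ne i
    have := w.partner_ne (i + 1)
    grind [capPartner, up, down]
  partner_partner := by
    intro j
    have := w.partner_partner (up i j)
    have := w.partner_partner i
    have := w.partner_partner (i + 1)
    have := w.partner_ne i
    have := w.partner_ne (i + 1)
    have := down_up i j
    have := up_down i (w.partner (up i j))
    have := up_down i (w.partner i)
    have := up_down i (w.partner (i + 1))
    have : up i j ≠ i ∧ up i j ≠ i + 1 := by grind [up]
    grind [capPartner]
  partner_of_ge := by
    intro j hj
    have := w.partner_of_ge (up i j)
    grind [capPartner, up, down]
  planar := by
    intro a b h₁ h₂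
    have e₁ := w.planar (up i a) (up i b)
    have e₂ := w.planar (w.partner (up i b)) (up i a)
    have e₃ := w.planar i (up i b)
    have e₄ := w.planar i (up i a)
    have e₅ := w.planar (i + 1) (up i b)
    have e₆ := w.planar (i + 1) (up i a)
    have f₁ := w.planar (up i a) i
    have f₂ := w.planar (up i a) (i + 1)
    have f₃ := w.planar (up i b) i
    have f₄ := w.planar (up i b) (i + 1)
    have d₁ := w.planar (up i a) (w.partner i)
    have d₂ := w.planar (up i a) (w.partner (i + 1))
    have d₃ := w.planar (up i b) (w.partner i)
    have d₄ := w.planar (up i b) (w.partner (i + 1))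
    have d₅ := w.planar (w.partner i) (w.partner (i + 1))
    have d₆ := w.planar (w.partner (i + 1)) (w.partner i)
    have d₇ := w.planar (w.partner (i + 1)) (up i b)
    have d₈ := w.planar (w.partner i) (up i b)
    have e₇ := w.partner_partner (up i a)
    have e₈ := w.partner_partner (up i b)
    have e₉ := w.partner_partner i
    have g₁ := w.partner_partner (i + 1)
    have g₂ := w.partner_ne i (by omega)
    have g₃ := w.partner_ne (i + 1) (by omega)
    have a₁ : up i a < up i b := by grind [up]
    have a₂ : up i a ≠ i ∧ up i a ≠ i + 1 := by grind [up]
    have a₃ : up i b ≠ i ∧ up i b ≠ i + 1 := by grind [up]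
    have key : ∀ x, b < down i x → up i b < x := by grind [up, down]
    have mono : ∀ x y, y < x → y ≠ i → y ≠ i + 1 → x ≠ i → x ≠ i + 1 →
        down i y < down i x := by grind [down]
    unfold capPartner at h₂ ⊢
    have k := key _ h₂
    clear key h₂
    generalize up i a = A at *
    generalize up i b = B at *
    refine mono _ _ ?_ ?_ ?_ ?_ ?_
    · clear mono
      split_ifs at k ⊢ <;> grind
    all_goals clear mono; split_ifs <;> grind

/-- The direct sum of all the web spaces `W_m`: the `ℚ(q^{1/4})`-vector space spanned by all
basis webs. -/
abbrev W : Type := BasisWeb →₀ K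

/-- The linear map `W_m → W_{m+2}` inserting an arc `⊂` at positions `i`, `i + 1`
(zero on `W_m` if `i > m`). -/
def cupOp (i : ℕ) : W →ₗ[K] W :=
  Finsupp.lift W K BasisWeb fun w =>
    if h : i ≤ w.ends then Finsupp.single (w.cup i h) 1 else 0

/-- The linear map `W_{m+2} → W_m` joining the end points `i`, `i + 1` by an arc `⊃`; if this
closes up a loop, the loop is replaced by the factor `-[2]`. (It is zero on `W_m` if
`i + 2 > m`.) -/
def capOp (i : ℕ) : W →ₗ[K] W :=
  Finsupp.lift W K BasisWeb fun w =>
    if h : i + 2 ≤ w.ends then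
      Finsupp.single (w.cap i h) (if w.partner i = i + 1 then -qInt 2 else 1)
    else 0

/-- Gluing `⊃⊂` to the end points `i`, `i + 1`. -/
def hookOp (i : ℕ) : W →ₗ[K] W := cupOp i ∘ₗ capOp i

/-- Kauffman's resolution of a crossing of the strands at positions `i`, `i + 1`. The crossing is
right-handed if the over-strand runs from the upper left to the lower right. -/
def crossOp (right : Bool) (i : ℕ) : W →ₗ[K] W :=
  if right then q4 • LinearMap.id + q4⁻¹ • hookOp i
  else q4⁻¹ • LinearMap.id + q4 • hookOp i

/-- The `A₁` clasp (Jones–Wenzl idempotent) on the `n` strands at positions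
`i, …, i + n - 1`. -/
def claspOp : ℕ → ℕ → (W →ₗ[K] W)
  | 0, _ => LinearMap.id
  | 1, _ => LinearMap.id
  | n + 2, i => claspOp (n + 1) i +
      (qInt (n + 1) / qInt (n + 2)) •
        (claspOp (n + 1) i ∘ₗ hookOp (i + n) ∘ₗ claspOp (n + 1) i)

/-! ## Unoriented diagrams with clasps, and the Kauffman bracket -/

/-- The elementary pieces into which an unoriented tangle diagram with clasps is cut by vertical
lines; the number is the position of the topmost strand involved. -/
inductive Piece : Type
  | cup (i : ℕ)
  | cap (i : ℕ)
  | cross (right : Bool) (i : ℕ)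
  | clasp (n i : ℕ)

/-- The effect of gluing an elementary piece. -/
def Piece.op : Piece → (W →ₗ[K] W)
  | .cup i => cupOp i
  | .cap i => capOp i
  | .cross right i => crossOp right i
  | .clasp n i => claspOp n i

/-- The Kauffman bracket `⟨ · ⟩₂`, with values in the web spaces, of the diagram obtained by
gluing the pieces of a list from left to right. -/
def bracket (L : List Piece) : W :=
  L.foldl (fun x P => P.op x) (Finsupp.single BasisWeb.empty 1)

/-- The bracket of a closed diagram as a scalar: its coefficient at the empty web, which spans
`W_0`. -/
def closedBracket (L : List Piece) : K := bracket L BasisWeb.empty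

/-! ## Parallels

The `n`-parallel of the strand at position `i` occupies positions `n i, …, n i + n - 1`. -/

/-- `n` nested arcs `⊂` starting at position `p`. -/
def cupCable (n p : ℕ) : List Piece := (List.range n).map fun a => .cup (p + a)

/-- `n` nested arcs `⊃` starting at position `p`. -/
def capCable (n p : ℕ) : List Piece := (List.range n).reverse.map fun a => .cap (p + a)

/-- A crossing of two bundles of `n` parallel strands at positions `p, …, p + n - 1` and
`p + n, …, p + 2 n - 1`: beginning with the lowest one, each strand of the first bundle crosses
the `n` strands of the second bundle. -/
def crossCable (right : Bool) (n p : ℕ) : List Piece :=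
  (List.range n).reverse.flatMap fun a => (List.range n).map fun b => .cross right (p + a + b)

/-! ## Oriented diagrams -/

/-- Oriented tangle diagrams, cut into elementary pieces by vertical lines, with all end points on
the right-hand side. The index lists from top to bottom the directions of the strands at the end
points: `true` if the strand is directed to the right, `false` if it is directed to the left.
In a crossing the strands at positions `l₁.length`, `l₁.length + 1` cross; it is right-handed if
the over-strand runs from the upper left to the lower right. -/
inductive Tangle : List Bool → Type
  | empty : Tangle []
  | cup (l₁ l₂ : List Bool) (b : Bool) (D : Tangle (l₁ ++ l₂)) : Tangle (l₁ ++ b :: (!b) :: l₂)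
  | cap (l₁ l₂ : List Bool) (b : Bool) (D : Tangle (l₁ ++ b :: (!b) :: l₂)) : Tangle (l₁ ++ l₂)
  | cross (right : Bool) (l₁ l₂ : List Bool) (b c : Bool) (D : Tangle (l₁ ++ b :: c :: l₂)) :
      Tangle (l₁ ++ c :: b :: l₂)

/-- An oriented link diagram is a tangle diagram without end points. -/
abbrev Link : Type := Tangle []

/-- The sum of the signs of the crossings. A right-handed crossing is positive if its two strands
run in the same horizontal direction, and negative if they run in opposite directions; a
left-handed crossing has the opposite sign. -/
def Tangle.writhe : {s : List Bool} → Tangle s → ℤ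
  | _, .empty => 0
  | _, .cup _ _ _ D => D.writhe
  | _, .cap _ _ _ D => D.writhe
  | _, .cross right _ _ b c D => D.writhe + (if (b == c) == right then 1 else -1)

/-- The partner function telling which end points belong to the same component. -/
def Tangle.conn : {s : List Bool} → Tangle s → ℕ → ℕ
  | _, .empty => id
  | _, .cup l₁ _ _ D => cupPartner l₁.length D.conn
  | _, .cap l₁ _ _ D => capPartner l₁.length D.conn
  | _, .cross _ l₁ _ _ _ D => swapPartner l₁.length D.conn

/-- The diagram colored by `n`: the orientation is forgotten, every strand is replaced by `n`
parallel strands, and one clasp is inserted in each component that is closed up. The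
short strand replaced by the clasp is taken just before the arc `⊃` that closes up the component,
i.e. that joins two end points of one and the same component. -/
def Tangle.colored (n : ℕ) : {s : List Bool} → Tangle s → List Piece
  | _, .empty => []
  | _, .cup l₁ _ _ D => D.colored n ++ cupCable n (n * l₁.length)
  | _, .cap l₁ _ _ D => D.colored n ++
      (if D.conn l₁.length = l₁.length + 1 then [Piece.clasp n (n * l₁.length)] else []) ++
      capCable n (n * l₁.length)
  | _, .cross right l₁ _ _ _ D => D.colored n ++ crossCable right n (n * l₁.length)

/-- The circle colored by `n`, with its clasp. -/
def coloredCircle (n : ℕ) : List Piece := cupCable n 0 ++ [Piece.clasp n 0] ++ capCable n 0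

/-- The `sl₂` colored Jones polynomial
`J_{n+1}(L; q) = ((-1)^n q^{(n²+2n)/4})^{-w(L)} ⟨L(n)⟩₂ / ⟨O(n)⟩₂`, `O` being the circle. -/
def coloredJones (n : ℕ) (L : Link) : K :=
  ((-1) ^ n * q4 ^ (n ^ 2 + 2 * n)) ^ (-L.writhe) *
    closedBracket (L.colored n) / closedBracket (coloredCircle n)

/-! ## The standard diagrams of 2-bridge links -/

/-- `k` full twists (`2k` half twists) of the strands at positions `l₁.length`,
`l₁.length + 1`. -/
def Tangle.fullTwists (right : Bool) (l₁ l₂ : List Bool) (b c : Bool) :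
    ℕ → Tangle (l₁ ++ b :: c :: l₂) → Tangle (l₁ ++ b :: c :: l₂)
  | 0, D => D
  | k + 1, D => .cross right l₁ l₂ c b (.cross right l₁ l₂ b c (fullTwists right l₁ l₂ b c k D))

/-- The box `2a`: `2|a|` half twists, right-handed if `a > 0` and left-handed if `a < 0`. -/
def Tangle.box (a : ℤ) (l₁ l₂ : List Bool) (b c : Bool) :
    Tangle (l₁ ++ b :: c :: l₂) → Tangle (l₁ ++ b :: c :: l₂) :=
  Tangle.fullTwists (decide (0 < a)) l₁ l₂ b c a.natAbs

/-- Two arcs `⊂`, one above the other: four strands, directed from top to bottom to the left,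
to the right, to the left, to the right. -/
def bridgeStart : Tangle [false, true, false, true] :=
  .cup [false, true] [] false (.cup [] [] false .empty)

/-- Glue the boxes of a list to four strands and close up. If the flag is `true`, the next box
is on the two middle strands (odd index), otherwise on the two lowest strands (even index);
the boxes alternate.
After the last box: if its index was even (or there was no box at all), close the two middle
strands with each other and the two outer strands with each other; if its index was odd, close
the two lowest strands with each other and the two highest strands with each other. -/
def Tangle.bridge : Bool → List ℤ → Tangle [false, true, false, true] → Link
  | true, [], D => .cap [] [] false (.cap [false] [true] true D)
  | false, [], D => .cap [] [] false (.cap [false, true] [] false D)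
  | true, a :: as, D => Tangle.bridge false as (Tangle.box a [false] [true] true false D)
  | false, a :: as, D => Tangle.bridge true as (Tangle.box a [false, true] [] false true D)

/-- The oriented diagram `[2a_1, 2a_2, …, 2a_l]`. -/
def twoBridge (a : List ℤ) : Link := Tangle.bridge true a bridgeStart

/-! ## The right-hand side -/

/-- The chains `0 ≤ k_m ≤ ⋯ ≤ k_1 ≤ N`; here `k_i` is `k (i - 1)`. -/
def chains (m N : ℕ) : Finset (Fin m → ℕ) :=
  {k ∈ Fintype.piFinset fun _ : Fin m => Finset.range (N + 1) | ∀ i j, i ≤ j → k j ≤ k i}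

/-- `k_0 = N, k_1, …, k_m`. -/
def extend {m : ℕ} (N : ℕ) (k : Fin m → ℕ) : Fin (m + 1) → ℕ := Fin.cons N k

/-- The last term `k_m` of `k_0 = N, k_1, …, k_m`. -/
def lastTerm {m : ℕ} (N : ℕ) (k : Fin m → ℕ) : ℕ := extend N k (Fin.last m)

/-- The list `k'_1, …, k'_m, k_m`, where `k'_{i+1} = k_i - k_{i+1}`. -/
def differences {m : ℕ} (N : ℕ) (k : Fin m → ℕ) : Fin (m + 1) → ℕ :=
  Fin.snoc (fun i : Fin m => extend N k i.castSucc - extend N k i.succ) (lastTerm N k)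

/-- The summand of a twist region with `|a| = m`, `ε = a / |a|`:
`(-1)^{N - k_m} q^{ε (N - k_m) / 2} q^{ε ∑ (k_i² + k_i)} (q^ε)_N / (q^ε)_{k_m}` times the
multinomial coefficient of `N` over `k'_1, …, k'_m, k_m` at `q^ε`. -/
def twistTerm (ε : ℤ) {m : ℕ} (N : ℕ) (k : Fin m → ℕ) : K :=
  (-1) ^ (N - lastTerm N k) * q4 ^ (2 * ε * ((N : ℤ) - lastTerm N k)) *
    q4 ^ (4 * ε * ∑ i, ((k i : ℤ) ^ 2 + k i)) *
    (poch (q4 ^ (4 * ε)) N / poch (q4 ^ (4 * ε)) (lastTerm N k)) *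
    qMultinomial (q4 ^ (4 * ε)) N (differences N k)

/-- The factor `(-1)^{n - N} q^{(N - n) / 2} (1 - q^{n+1}) / (1 - q^{N+1})`. -/
def closingTerm (n N : ℕ) : K :=
  (-1) ^ (n - N) * q4 ^ (2 * ((N : ℤ) - n)) *
    ((1 - q4 ^ (4 * (n + 1))) / (1 - q4 ^ (4 * (N + 1))))

/-- The iterated sum over the twist regions `a_{j+1}, …, a_l`, starting with `N = K_j`; the sum
for `a_{j+1}` is over the chains `0 ≤ k_{|a_{j+1}|} ≤ ⋯ ≤ k_1 ≤ K_j`, and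
`K_{j+1} = n - k_{|a_{j+1}|}`. -/
def twistSum (n : ℕ) : List ℤ → ℕ → K
  | [], N => closingTerm n N
  | a :: as, N => ∑ k ∈ chains a.natAbs N,
      twistTerm a.sign N k * twistSum n as (n - lastTerm N k)

end ColoredJones

end

/-!
The `n`-parallel of a 2-bridge diagram starts from four bundles of `n` strands, and its closing
part kills every turnback in one of the bundles, because each bundle leads to a Jones–Wenzl
idempotent (`closing_killsTurnbacks`). The twist regions can therefore be evaluated one after the
other, modulo turnbacks, in the span of the crossingless diagrams of four bundles without
turnbacks: `planarState n b K`, in which `n - K` arcs join the two bundles that are twisted next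
(`b` tells whether these are the middle or the lower ones).

*Half twists.* To let two bundles cross once, resolve the crossing of their two innermost strands.
If the strands go on as parallels, their other crossings are absorbed at the cost of powers of
`A = q^{±1/4}`. If they turn back, the arc is pulled through the crossing of the remaining strands
(`bundleCross_mul_U`) and its crossings with them are then absorbed as well. By induction this gives
the expansion `mul_bundleCross_mul`, with coefficients satisfying Pascal's recursion: they are
Gaussian binomials (`halfTwistCoeff_mul_qPoch`). Arcs that are already there are pulled through at
the cost of a curl each (`mul_bundleCross_mul_nest`).

*Full twists.* The matrix of a full twist is the square of the one of a half twist, and the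
`q`-binomial theorem evaluates its entries
(`KillsTurnbacks.mul_fullTwist_mul_planarState`). Once the framing factor is included they do not
depend on `n`, and the product of `|a_j|` of them is the summand `T_j` of the formula
(`twistTerm_cons`).

*Passing on, and closing up.* The state with `n - K` arcs between the middle bundles has `K` arcs
between the lower ones (`planarState_not`); this is why the next twist region starts from
`n - k_{|a_j|}`. At the end, the `n - K` arcs that join the bundles to be closed up give a partial
trace of a Jones–Wenzl idempotent, which is the quotient of quantum integers in the closing factor
(`closing_mul_planarState`). If the diagram is a knot, it carries a single idempotent; the
second one that the argument uses may be inserted, since turnbacks slide through the twist regions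
and around the initial arcs to the first one (`closing_mul_twists_mul_nest`).

*The algebra.* All of this is carried out in an algebra with generators `U i`, `D i` for the arcs
`⊂` and `⊃` at position `i` and with the relations of planar isotopy (`CupCap`). The web spaces
`W_m` yield such relations only for positions that fit into the number of end points. To get rid of
these bounds, webs are extended by infinitely many arcs below their end points; arcs then act on
the matchings of all natural numbers (`infCupCap`), and the scalar of a closed diagram is read off
there (`Intertwines.closedBracket_eq`).
-/

noncomputable section

namespace ColoredJones

/-- Elements `U i`, `D i` of an algebra that satisfy the planar isotopy relations of arcs `⊂`
and `⊃` at the positions `i`, `i + 1` on a line with infinitely many strands; a loop is worth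
the scalar `loop`. Since there are always enough strands, no relation carries a bound on the
position. -/
structure CupCap (k R : Type*) [Field k] [Ring R] [Algebra k R] where
  loop : k
  U : ℕ → R
  D : ℕ → R
  D_U_self : ∀ i, D i * U i = loop • (1 : R)
  D_U_succ : ∀ i, D i * U (i + 1) = 1
  D_succ_U : ∀ i, D (i + 1) * U i = 1
  U_U : ∀ i j, i ≤ j → U (j + 2) * U i = U i * U j
  D_D : ∀ i j, i ≤ j → D i * D (j + 2) = D j * D i
  D_U_of_le : ∀ i j, i ≤ j → D (j + 2) * U i = U i * D j
  D_U_of_ge : ∀ i j, i ≤ j → D i * U (j + 2) = U j * D i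

namespace CupCap

variable {k R : Type*} [Field k] [Ring R] [Algebra k R] (S : CupCap k R)

/-! ### Hooks and crossings -/

/-- The hook `⊃⊂` at the positions `i`, `i + 1`. -/
def e (i : ℕ) : R := S.U i * S.D i

/-- The crossing at the positions `i`, `i + 1`, resolved with the parameter `A`: right-handed for
`A = q^{1/4}`, left-handed for `A = q^{-1/4}`. -/
def g (A : k) (i : ℕ) : R := A • (1 : R) + A⁻¹ • S.e i

lemma D_mul_e_succ (i : ℕ) : S.D i * S.e (i + 1) = S.D (i + 1) := by
  rw [e, ← mul_assoc, S.D_U_succ, one_mul]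

lemma D_succ_mul_e (i : ℕ) : S.D (i + 1) * S.e i = S.D i := by
  rw [e, ← mul_assoc, S.D_succ_U, one_mul]

lemma e_mul_U_succ (i : ℕ) : S.e i * S.U (i + 1) = S.U i := by
  rw [e, mul_assoc, S.D_U_succ, mul_one]

lemma e_succ_mul_U (i : ℕ) : S.e (i + 1) * S.U i = S.U (i + 1) := by
  rw [e, mul_assoc, S.D_succ_U, mul_one]

lemma e_mul_U_self (i : ℕ) : S.e i * S.U i = S.loop • S.U i := by
  rw [e, mul_assoc, S.D_U_self, mul_smul_comm, mul_one]

lemma e_mul_self (i : ℕ) : S.e i * S.e i = S.loop • S.e i := by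
  calc S.e i * S.e i = S.e i * S.U i * S.D i := by rw [mul_assoc, ← e]
    _ = _ := by rw [e_mul_U_self, smul_mul_assoc, ← e]

lemma e_mul_e_succ_mul_e (i : ℕ) : S.e i * S.e (i + 1) * S.e i = S.e i := by
  rw [mul_assoc]
  nth_rw 1 [e]
  rw [mul_assoc, ← mul_assoc (S.D i), D_mul_e_succ, D_succ_mul_e, e]

lemma e_succ_mul_e_mul_e_succ (i : ℕ) : S.e (i + 1) * S.e i * S.e (i + 1) = S.e (i + 1) := by
  rw [mul_assoc]
  nth_rw 1 [e]
  rw [mul_assoc, ← mul_assoc (S.D (i + 1)), D_succ_mul_e, D_mul_e_succ, e]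

lemma e_mul_U_of_le {i j : ℕ} (h : i + 2 ≤ j) : S.e i * S.U j = S.U j * S.e i := by
  obtain ⟨k, rfl⟩ := Nat.exists_eq_add_of_le' h
  rw [e, mul_assoc, show k + (i + 2) = (k + i) + 2 by ring, S.D_U_of_ge i (k + i) (by omega),
    ← mul_assoc, ← S.U_U i (k + i) (by omega), mul_assoc]

lemma e_mul_U_of_ge {i j : ℕ} (h : j ≤ i) : S.e (i + 2) * S.U j = S.U j * S.e i := by
  rw [e, mul_assoc, S.D_U_of_le j i h, ← mul_assoc, S.U_U j i h, mul_assoc, ← e]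

lemma D_mul_e_of_le {i j : ℕ} (h : i + 2 ≤ j) : S.D j * S.e i = S.e i * S.D j := by
  obtain ⟨k, rfl⟩ := Nat.exists_eq_add_of_le' h
  rw [e, ← mul_assoc, show k + (i + 2) = (k + i) + 2 by ring, S.D_U_of_le i (k + i) (by omega),
    mul_assoc, ← S.D_D i (k + i) (by omega), mul_assoc]

lemma D_mul_e_of_ge {i j : ℕ} (h : j ≤ i) : S.D j * S.e (i + 2) = S.e i * S.D j := by
  rw [e, ← mul_assoc, S.D_U_of_ge j i h, mul_assoc, S.D_D j i h, ← mul_assoc, ← e]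

lemma commute_e {i j : ℕ} (h : i + 2 ≤ j) : Commute (S.e i) (S.e j) := by
  calc S.e i * S.e j = S.e i * S.U j * S.D j := by rw [mul_assoc, ← e]
    _ = S.U j * S.D j * S.e i := by
      rw [S.e_mul_U_of_le h, mul_assoc, mul_assoc, S.D_mul_e_of_le h]

/-! ### Elements supported on a range of positions -/

/-- `T` involves only the strands at the positions `a, …, b - 1`, in the sense that it commutes
with the hooks on the strands above and below. -/
def Local (a b : ℕ) (T : R) : Prop := ∀ j, j + 2 ≤ a ∨ b ≤ j → Commute T (S.e j)

variable {S}

namespace Local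

variable {a b : ℕ} {T T' : R}

lemma one : S.Local a b 1 := fun _ _ => Commute.one_left _

lemma mul (h : S.Local a b T) (h' : S.Local a b T') : S.Local a b (T * T') :=
  fun j hj => (h j hj).mul_left (h' j hj)

lemma add (h : S.Local a b T) (h' : S.Local a b T') : S.Local a b (T + T') :=
  fun j hj => (h j hj).add_left (h' j hj)

lemma smul (x : k) (h : S.Local a b T) : S.Local a b (x • T) :=
  fun j hj => (h j hj).smul_left x

lemma mono {a' b' : ℕ} (h : S.Local a b T) (ha : a' ≤ a) (hb : b ≤ b') : S.Local a' b' T :=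
  fun j hj => h j (by omega)

lemma e {i : ℕ} (ha : a ≤ i) (hb : i + 2 ≤ b) : S.Local a b (S.e i) := by
  rintro j (hj | hj)
  · exact (S.commute_e (by omega)).symm
  · exact S.commute_e (by omega)

lemma g (A : k) {i : ℕ} (ha : a ≤ i) (hb : i + 2 ≤ b) : S.Local a b (S.g A i) :=
  (one.smul A).add ((e ha hb).smul A⁻¹)

end Local

variable (S)

lemma commute_g_of_commute (A : k) {T : R} {j : ℕ} (h : Commute T (S.e j)) :
    Commute T (S.g A j) :=
  ((Commute.one_right T).smul_right A).add_right (h.smul_right A⁻¹)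

variable {S} in
lemma Local.commute_g {a b : ℕ} {T : R} (h : S.Local a b T) (A : k) {j : ℕ}
    (hj : j + 2 ≤ a ∨ b ≤ j) : Commute T (S.g A j) :=
  S.commute_g_of_commute A (h j hj)

/-! ### Braid relations -/

section Braid

variable {A : k}

lemma g_mul_U_self (hA : A ≠ 0) (h2 : S.loop = -(A ^ 2 + A⁻¹ ^ 2)) (i : ℕ) :
    S.g A i * S.U i = (-A⁻¹ ^ 3) • S.U i := by
  rw [g, add_mul, smul_mul_assoc, one_mul, smul_mul_assoc, e_mul_U_self, smul_smul, ← add_smul, h2]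
  congr 1
  field_simp
  ring

/-- A strand that crosses the lower leg of an arc `⊂` from below can be moved to cross the upper
leg from above. -/
lemma g_succ_mul_U (i : ℕ) : S.g A (i + 1) * S.U i = S.g A⁻¹ i * S.U (i + 1) := by
  simp only [g, add_mul, smul_mul_assoc, one_mul, e_succ_mul_U, e_mul_U_succ, inv_inv]
  abel

lemma g_mul_g_inv (hA : A ≠ 0) (h2 : S.loop = -(A ^ 2 + A⁻¹ ^ 2)) (i : ℕ) :
    S.g A i * S.g A⁻¹ i = 1 := by
  simp only [g, add_mul, mul_add, smul_mul_assoc, mul_smul_comm, one_mul, mul_one, smul_add,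
    smul_smul, inv_inv, e_mul_self]
  rw [h2]
  match_scalars <;> field_simp
  ring

lemma g_braid (hA : A ≠ 0) (h2 : S.loop = -(A ^ 2 + A⁻¹ ^ 2)) (i : ℕ) :
    S.g A i * S.g A (i + 1) * S.g A i = S.g A (i + 1) * S.g A i * S.g A (i + 1) := by
  simp only [g, add_mul, mul_add, smul_mul_assoc, mul_smul_comm, one_mul, mul_one, smul_add,
    smul_smul, e_mul_self, e_mul_e_succ_mul_e, e_succ_mul_e_mul_e_succ]
  rw [h2]
  match_scalars <;> field_simp <;> ring

lemma g_mul_g_mul_e (hA : A ≠ 0) (h2 : S.loop = -(A ^ 2 + A⁻¹ ^ 2)) (i : ℕ) :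
    S.g A i * S.g A (i + 1) * S.e i = S.e (i + 1) * (S.g A i * S.g A (i + 1)) := by
  simp only [g, add_mul, mul_add, smul_mul_assoc, mul_smul_comm, one_mul, mul_one, smul_add,
    smul_smul, e_mul_self, e_mul_e_succ_mul_e, ← mul_assoc, e_succ_mul_e_mul_e_succ]
  rw [h2]
  match_scalars <;> field_simp <;> ring

lemma g_succ_mul_g_mul_e (hA : A ≠ 0) (h2 : S.loop = -(A ^ 2 + A⁻¹ ^ 2)) (i : ℕ) :
    S.g A (i + 1) * S.g A i * S.e (i + 1) = S.e i * (S.g A (i + 1) * S.g A i) := by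
  simp only [g, add_mul, mul_add, smul_mul_assoc, mul_smul_comm, one_mul, mul_one, smul_add,
    smul_smul, e_mul_self, e_mul_e_succ_mul_e, ← mul_assoc, e_succ_mul_e_mul_e_succ]
  rw [h2]
  match_scalars <;> field_simp <;> ring

/-- The third Reidemeister move for strands on three different levels. -/
lemma g_braid_mixed (hA : A ≠ 0) (h2 : S.loop = -(A ^ 2 + A⁻¹ ^ 2)) (i : ℕ) :
    S.g A (i + 1) * S.g A i * S.g A⁻¹ (i + 1) = S.g A⁻¹ i * S.g A (i + 1) * S.g A i := by
  have h2' : S.loop = -(A⁻¹ ^ 2 + A⁻¹⁻¹ ^ 2) := by rw [h2, inv_inv, add_comm]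
  have h' := S.g_mul_g_inv (inv_ne_zero hA) h2' i
  rw [inv_inv] at h'
  calc S.g A (i + 1) * S.g A i * S.g A⁻¹ (i + 1)
      = S.g A⁻¹ i * S.g A i * (S.g A (i + 1) * S.g A i * S.g A⁻¹ (i + 1)) := by rw [h', one_mul]
    _ = S.g A⁻¹ i * (S.g A i * S.g A (i + 1) * S.g A i) * S.g A⁻¹ (i + 1) := by
        simp only [mul_assoc]
    _ = S.g A⁻¹ i * S.g A (i + 1) * S.g A i * (S.g A (i + 1) * S.g A⁻¹ (i + 1)) := by
        rw [S.g_braid hA h2]; simp only [mul_assoc]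
    _ = _ := by rw [S.g_mul_g_inv hA h2, mul_one]

end Braid

/-! ### Crossings of bundles -/

/-- The strand at position `p` crosses the `N` strands below it. -/
def row (A : k) : ℕ → ℕ → R
  | 0, _ => 1
  | N + 1, p => S.g A (p + N) * row A N p

/-- The strand at position `p + M` crosses the `M` strands above it. -/
def col (A : k) : ℕ → ℕ → R
  | 0, _ => 1
  | M + 1, p => col A M p * S.g A (p + M)

/-- A bundle of `M` strands, starting at position `p`, crosses the bundle of the next `N`
strands. -/
def bundleCross (A : k) : ℕ → ℕ → ℕ → R
  | 0, _, _ => 1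
  | M + 1, N, p => S.row A N p * bundleCross A M N (p + 1)

lemma row_local (A : k) (N p : ℕ) : S.Local p (p + N + 1) (S.row A N p) := by
  induction N with
  | zero => exact Local.one
  | succ N ih => exact (Local.g A (by omega) (by omega)).mul (ih.mono le_rfl (by omega))

lemma col_local (A : k) (M p : ℕ) : S.Local p (p + M + 1) (S.col A M p) := by
  induction M with
  | zero => exact Local.one
  | succ M ih => exact (ih.mono le_rfl (by omega)).mul (Local.g A (by omega) (by omega))

lemma bundleCross_local (A : k) (M N p : ℕ) :
    S.Local p (p + M + N) (S.bundleCross A M N p) := by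
  induction M generalizing p with
  | zero => exact Local.one
  | succ M ih =>
    exact ((S.row_local A N p).mono le_rfl (by omega)).mul ((ih (p + 1)).mono (by omega) (by omega))

lemma row_succ_right (A : k) (N p : ℕ) :
    S.row A (N + 1) p = S.row A N (p + 1) * S.g A p := by
  induction N with
  | zero => simp [row]
  | succ N ih =>
    rw [row, ih, ← mul_assoc, row, show p + 1 + N = p + (N + 1) by ring]

lemma col_succ_left (A : k) (M p : ℕ) :
    S.col A (M + 1) p = S.g A p * S.col A M (p + 1) := by
  induction M with
  | zero => simp [col]
  | succ M ih =>
    rw [col, ih, mul_assoc, col, show p + 1 + M = p + (M + 1) by ring]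

lemma bundleCross_succ_col (A : k) (M N p : ℕ) :
    S.bundleCross A M (N + 1) p = S.bundleCross A M N (p + 1) * S.col A M p := by
  induction M generalizing p with
  | zero => simp [bundleCross, col]
  | succ M ih =>
    have h := (S.bundleCross_local A M N (p + 1 + 1)).commute_g A (j := p) (.inl (by omega))
    rw [bundleCross, ih, row_succ_right, bundleCross, col_succ_left]
    simp only [mul_assoc]
    rw [← mul_assoc (S.g A p), ← h.eq, mul_assoc]

lemma bundleCross_succ_row (A : k) (M N p : ℕ) :
    S.bundleCross A (M + 1) N p = S.bundleCross A M N p * S.row A N (p + M) := by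
  induction M generalizing p with
  | zero => simp [bundleCross]
  | succ M ih =>
    rw [bundleCross, ih, ← mul_assoc, bundleCross, show p + 1 + M = p + (M + 1) by ring]

/-- The crossing of the two innermost strands is carried out first, the one of the two
remaining bundles last. -/
lemma bundleCross_succ_succ (A : k) (N p : ℕ) :
    S.bundleCross A (N + 1) (N + 1) p =
      S.bundleCross A N N (p + 1) * S.col A N p * S.row A N (p + N + 1) * S.g A (p + N) := by
  rw [bundleCross_succ_row, bundleCross_succ_col, row_succ_right]
  simp only [mul_assoc]

section Slide

variable {A : k} (hA : A ≠ 0) (h2 : S.loop = -(A ^ 2 + A⁻¹ ^ 2))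
include hA h2

lemma col_mul_e (M p i : ℕ) (hp : p ≤ i) (hi : i + 2 ≤ p + M) :
    S.col A M p * S.e i = S.e (i + 1) * S.col A M p := by
  induction M with
  | zero => omega
  | succ M ih =>
    rcases Nat.lt_or_ge (p + M) (i + 2) with h | h
    · obtain ⟨L, rfl⟩ : ∃ L, M = L + 1 := ⟨M - 1, by omega⟩
      obtain rfl : i = p + L := by omega
      rw [col, col, mul_assoc (S.col A L p), mul_assoc, ← add_assoc, S.g_mul_g_mul_e hA h2,
        ← mul_assoc, (S.col_local A L p _ (.inr (by omega))).eq, mul_assoc]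
    · have hc := S.commute_g_of_commute A (S.commute_e (i := i) (j := p + M) (by omega))
      rw [col, mul_assoc, ← hc.eq, ← mul_assoc, ih (by omega), mul_assoc]

lemma row_mul_e (N p i : ℕ) (hp : p ≤ i) (hi : i + 2 ≤ p + N) :
    S.row A N p * S.e (i + 1) = S.e i * S.row A N p := by
  induction N with
  | zero => omega
  | succ N ih =>
    rcases Nat.lt_or_ge (p + N) (i + 2) with h | h
    · obtain ⟨L, rfl⟩ : ∃ L, N = L + 1 := ⟨N - 1, by omega⟩
      obtain rfl : i = p + L := by omega
      rw [row, row, mul_assoc, mul_assoc, (S.row_local A L p _ (.inr (by omega))).eq,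
        ← mul_assoc (S.g A (p + L)), ← mul_assoc, ← add_assoc, ← mul_assoc,
        S.g_succ_mul_g_mul_e hA h2]
      simp only [mul_assoc]
    · have hc := S.commute_g_of_commute A (S.commute_e (i := i) (j := p + N) (by omega))
      rw [row, mul_assoc, ih (by omega), ← mul_assoc, ← hc.eq, mul_assoc]

lemma bundleCross_mul_e_upper (M N p i : ℕ) (hp : p ≤ i) (hi : i + 2 ≤ p + M) :
    S.bundleCross A M N p * S.e i = S.e (i + N) * S.bundleCross A M N p := by
  induction N generalizing p i with
  | zero =>
    have : ∀ M p, S.bundleCross A M 0 p = 1 := by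
      intro M
      induction M with
      | zero => simp [bundleCross]
      | succ M ih => simp [bundleCross, row, ih]
    simp [this]
  | succ N ih =>
    rw [bundleCross_succ_col, mul_assoc, S.col_mul_e hA h2 M p i hp hi, ← mul_assoc,
      ih (p + 1) (i + 1) (by omega) (by omega), mul_assoc, show i + 1 + N = i + (N + 1) by ring]

lemma bundleCross_mul_e_lower (M N p i : ℕ) (hp : p ≤ i) (hi : i + 2 ≤ p + N) :
    S.bundleCross A M N p * S.e (i + M) = S.e i * S.bundleCross A M N p := by
  induction M generalizing p i with
  | zero => simp [bundleCross]
  | succ M ih =>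
    rw [bundleCross, mul_assoc, show i + (M + 1) = i + 1 + M by ring,
      ih (p + 1) (i + 1) (by omega) (by omega), ← mul_assoc, S.row_mul_e hA h2 N p i hp (by omega),
      mul_assoc]

lemma row_slide (N q : ℕ) :
    S.row A N (q + 1) * S.g A q * S.col A⁻¹ N (q + 1) =
      S.col A⁻¹ N q * S.g A (q + N) * S.row A N q := by
  induction N with
  | zero => simp [row, col]
  | succ N ih =>
    have h₁ := (S.row_local A N q).commute_g A⁻¹ (j := q + 1 + N) (.inr (by omega))
    have h₂ := (S.col_local A⁻¹ N q).commute_g A (j := q + 1 + N) (.inr (by omega))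
    have h₃ := S.g_braid_mixed hA h2 (q + N)
    rw [show q + N + 1 = q + 1 + N by ring] at h₃
    calc S.row A (N + 1) (q + 1) * S.g A q * S.col A⁻¹ (N + 1) (q + 1)
        = S.g A (q + 1 + N) * (S.row A N (q + 1) * S.g A q * S.col A⁻¹ N (q + 1)) *
            S.g A⁻¹ (q + 1 + N) := by simp only [row, col, mul_assoc]
      _ = S.g A (q + 1 + N) * S.col A⁻¹ N q * S.g A (q + N) *
            (S.row A N q * S.g A⁻¹ (q + 1 + N)) := by rw [ih]; simp only [mul_assoc]
      _ = S.col A⁻¹ N q * (S.g A (q + 1 + N) * S.g A (q + N) * S.g A⁻¹ (q + 1 + N)) *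
            S.row A N q := by rw [h₁.eq, ← h₂.eq]; simp only [mul_assoc]
      _ = _ := by
        rw [h₃, show q + (N + 1) = q + 1 + N by ring]
        simp only [row, col, mul_assoc]

/-- A strand that passes under the upper and over the lower one of two bundles can be moved
across their crossing. -/
lemma bundleCross_slide (M N p : ℕ) :
    S.bundleCross A M N (p + 1) * (S.col A M p * S.col A⁻¹ N (p + M)) =
      S.col A⁻¹ N p * S.col A M (p + N) * S.bundleCross A M N p := by
  induction M generalizing p with
  | zero => simp [bundleCross, col]
  | succ M ih =>
    have h₁ := (S.bundleCross_local A M N (p + 1 + 1)).commute_g A (j := p) (.inl (by omega))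
    have h₂ : Commute (S.row A N p) (S.col A M (p + N + 1)) := by
      have : ∀ M, Commute (S.row A N p) (S.col A M (p + N + 1)) := by
        intro M
        induction M with
        | zero => exact Commute.one_right _
        | succ M ih' => exact ih'.mul_right ((S.row_local A N p).commute_g A (.inr (by omega)))
      exact this M
    calc S.bundleCross A (M + 1) N (p + 1) * (S.col A (M + 1) p * S.col A⁻¹ N (p + (M + 1)))
        = S.row A N (p + 1) * (S.bundleCross A M N (p + 1 + 1) * S.g A p) *
            (S.col A M (p + 1) * S.col A⁻¹ N (p + 1 + M)) := by
          rw [col_succ_left, bundleCross, show p + (M + 1) = p + 1 + M by ring]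
          simp only [mul_assoc]
      _ = S.row A N (p + 1) * S.g A p * (S.bundleCross A M N (p + 1 + 1) *
            (S.col A M (p + 1) * S.col A⁻¹ N (p + 1 + M))) := by
          rw [h₁.eq]; simp only [mul_assoc]
      _ = S.row A N (p + 1) * S.g A p * S.col A⁻¹ N (p + 1) * (S.col A M (p + 1 + N) *
            S.bundleCross A M N (p + 1)) := by
          rw [ih]; simp only [mul_assoc]
      _ = S.col A⁻¹ N p * S.g A (p + N) * (S.row A N p * S.col A M (p + N + 1)) *
            S.bundleCross A M N (p + 1) := by
          rw [S.row_slide hA h2, show p + 1 + N = p + N + 1 by ring]; simp only [mul_assoc]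
      _ = _ := by
          rw [h₂.eq, col_succ_left, bundleCross]
          simp only [mul_assoc]

omit hA h2 in
/-- An arc whose lower leg crosses the `N` strands below it is pushed below these strands; then
its upper leg crosses them. -/
lemma row_mul_U (A : k) (N p : ℕ) :
    S.row A N (p + 1) * S.U p = S.col A⁻¹ N p * S.U (p + N) := by
  induction N with
  | zero => simp [row, col]
  | succ N ih =>
    have h := (S.col_local A⁻¹ N p).commute_g A (j := p + N + 1) (.inr (by omega))
    rw [row, mul_assoc, ih, show p + 1 + N = p + N + 1 by ring, ← mul_assoc, ← h.eq, mul_assoc,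
      g_succ_mul_U, col, mul_assoc, add_assoc]

/-- An arc between two bundles, its legs passing under the upper and over the lower bundle, can
be pulled through the crossing of the bundles; then its legs cross them with the opposite
handedness. -/
lemma bundleCross_mul_U (N p : ℕ) :
    S.bundleCross A N N (p + 1) * S.col A N p * S.row A N (p + N + 1) * S.U (p + N) =
      S.col A⁻¹ N p * S.row A⁻¹ N (p + N + 1) * S.U (p + N) * S.bundleCross A N N p := by
  have h : Commute (S.bundleCross A N N p) (S.U (p + N + N)) := by
    have hg : ∀ j, j + 2 ≤ p + N + N → Commute (S.g A j) (S.U (p + N + N)) := fun j hj =>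
      ((Commute.one_left _).smul_left A).add_left
        (Commute.smul_left (S.e_mul_U_of_le hj) A⁻¹)
    have hr : ∀ L q, q + L + 1 ≤ p + N + N → Commute (S.row A L q) (S.U (p + N + N)) := by
      intro L q hq
      induction L with
      | zero => exact Commute.one_left _
      | succ L ih => exact (hg _ (by omega)).mul_left (ih (by omega))
    have : ∀ M q, q + M + N ≤ p + N + N → Commute (S.bundleCross A M N q) (S.U (p + N + N)) := by
      intro M
      induction M with
      | zero => exact fun _ _ => Commute.one_left _
      | succ M ih => exact fun q hq => (hr _ _ (by omega)).mul_left (ih _ (by omega))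
    exact this N p le_rfl
  have h₁ := S.row_mul_U A N (p + N)
  have h₂ := S.row_mul_U A⁻¹ N (p + N)
  rw [inv_inv] at h₂
  simp only [mul_assoc] at h₁ h₂ ⊢
  rw [h₁, ← mul_assoc (S.row A⁻¹ N (p + N + 1)), h₂, mul_assoc, ← h.eq,
    ← mul_assoc (S.col A N p), ← mul_assoc (S.bundleCross A N N (p + 1)),
    S.bundleCross_slide hA h2 N N p]
  simp only [mul_assoc]

end Slide

/-! ### Nested arcs -/

/-- `j` nested arcs `⊂` at the positions `p, …, p + 2 j - 1`. -/
def nest : ℕ → ℕ → R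
  | 0, _ => 1
  | j + 1, p => S.U (p + j) * nest j p

/-- `j` nested arcs `⊃` at the positions `p, …, p + 2 j - 1`. -/
def capNest : ℕ → ℕ → R
  | 0, _ => 1
  | j + 1, p => capNest j p * S.D (p + j)

lemma nest_add (a b p : ℕ) : S.nest (a + b) p = S.nest a (p + b) * S.nest b p := by
  induction a with
  | zero => simp [nest]
  | succ a ih =>
    rw [show a + 1 + b = a + b + 1 by ring, nest, ih, nest, mul_assoc,
      show p + b + a = p + (a + b) by ring]

lemma capNest_add (a b p : ℕ) :
    S.capNest (a + b) p = S.capNest b p * S.capNest a (p + b) := by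
  induction a with
  | zero => simp [capNest]
  | succ a ih =>
    rw [show a + 1 + b = a + b + 1 by ring, capNest, ih, capNest, mul_assoc,
      show p + b + a = p + (a + b) by ring]

lemma nest_succ_right (j p : ℕ) : S.nest (j + 1) p = S.nest j (p + 1) * S.U p := by
  rw [nest_add]; simp [nest]

lemma capNest_succ_left (j p : ℕ) : S.capNest (j + 1) p = S.D p * S.capNest j (p + 1) := by
  rw [capNest_add]; simp [capNest]

lemma e_mul_nest_of_le {i p : ℕ} (j : ℕ) (h : i + 2 ≤ p) :
    S.e i * S.nest j p = S.nest j p * S.e i := by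
  induction j with
  | zero => simp [nest]
  | succ j ih =>
    rw [nest, ← mul_assoc, S.e_mul_U_of_le (by omega), mul_assoc, ih, mul_assoc]

lemma e_mul_nest_of_ge {i p : ℕ} (j : ℕ) (h : p ≤ i) :
    S.e (i + 2 * j) * S.nest j p = S.nest j p * S.e i := by
  induction j with
  | zero => simp [nest]
  | succ j ih =>
    rw [nest, ← mul_assoc, show i + 2 * (j + 1) = i + 2 * j + 2 by ring,
      S.e_mul_U_of_ge (by omega), mul_assoc, ih, mul_assoc]

lemma capNest_mul_e_of_le {i p : ℕ} (j : ℕ) (h : i + 2 ≤ p) :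
    S.capNest j p * S.e i = S.e i * S.capNest j p := by
  induction j with
  | zero => simp [capNest]
  | succ j ih =>
    rw [capNest, mul_assoc, S.D_mul_e_of_le (by omega), ← mul_assoc, ih, mul_assoc]

lemma capNest_mul_e_of_ge {i p : ℕ} (j : ℕ) (h : p ≤ i) :
    S.capNest j p * S.e (i + 2 * j) = S.e i * S.capNest j p := by
  induction j generalizing i with
  | zero => simp [capNest]
  | succ j ih =>
    rw [capNest, mul_assoc, show i + 2 * (j + 1) = i + 2 * j + 2 by ring,
      S.D_mul_e_of_ge (by omega), ← mul_assoc, ih h, mul_assoc]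

lemma D_mul_nest_of_le {i p : ℕ} (j : ℕ) (h : i + 2 ≤ p) :
    S.D i * S.nest j p = S.nest j (p - 2) * S.D i := by
  induction j with
  | zero => simp [nest]
  | succ j ih =>
    obtain ⟨p, rfl⟩ : ∃ p', p = p' + 2 := ⟨p - 2, by omega⟩
    rw [nest, ← mul_assoc, show p + 2 + j = p + j + 2 by ring, S.D_U_of_ge i _ (by omega),
      mul_assoc, ih, Nat.add_sub_cancel, nest, mul_assoc]

lemma D_mul_nest_of_ge {i p : ℕ} (j : ℕ) (h : p ≤ i) :
    S.D (i + 2 * j) * S.nest j p = S.nest j p * S.D i := by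
  induction j with
  | zero => simp [nest]
  | succ j ih =>
    rcases Nat.eq_zero_or_pos j with rfl | hj
    · simpa [nest] using S.D_U_of_le p i h
    rw [nest, ← mul_assoc, show i + 2 * (j + 1) = (i + 2 * j) + 2 by ring,
      S.D_U_of_le _ _ (by omega), mul_assoc, ih, mul_assoc]

lemma U_mul_nest {i p : ℕ} (j : ℕ) (h : i ≤ p) :
    S.nest j (p + 2) * S.U i = S.U i * S.nest j p := by
  induction j with
  | zero => simp [nest]
  | succ j ih =>
    rw [nest, mul_assoc, ih, ← mul_assoc, show p + 2 + j = p + j + 2 by ring,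
      S.U_U _ _ (by omega), mul_assoc, nest]

lemma nest_mul_nest {p q : ℕ} (i j : ℕ) (h : p ≤ q) :
    S.nest j (q + 2 * i) * S.nest i p = S.nest i p * S.nest j q := by
  induction i with
  | zero => simp [nest]
  | succ i ih =>
    rw [nest, show q + 2 * (i + 1) = q + 2 * i + 2 by ring, ← mul_assoc,
      S.U_mul_nest j (by omega), mul_assoc, ih, mul_assoc]

/-- A hook on two neighbouring arcs of a nest slides along these arcs to their other ends. -/
lemma e_mul_nest_reflect {i i' p : ℕ} (j : ℕ) (h₁ : p + j ≤ i) (h₂ : i + 2 ≤ p + 2 * j)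
    (h : i + i' + 2 = 2 * (p + j)) : S.e i * S.nest j p = S.e i' * S.nest j p := by
  induction j generalizing p with
  | zero => omega
  | succ j ih =>
    rcases Nat.lt_or_ge i (p + 2 * j) with hi | hi
    · rw [nest_succ_right, ← mul_assoc, ← mul_assoc, ih (by omega) (by omega) (by omega)]
    · obtain rfl : i = p + 2 * j := by omega
      obtain rfl : i' = p := by omega
      obtain ⟨j, rfl⟩ : ∃ j', j = j' + 1 := ⟨j - 1, by omega⟩
      have key : S.e (i' + 2) * (S.U (i' + 1) * S.U i') = S.e i' * (S.U (i' + 1) * S.U i') := by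
        rw [← mul_assoc, ← mul_assoc, S.e_mul_U_succ, S.e_succ_mul_U, S.U_U i' i' le_rfl]
      have key' : S.nest (j + 2) i' = S.nest j (i' + 2) * (S.U (i' + 1) * S.U i') := by
        rw [nest_succ_right, nest_succ_right, mul_assoc]
      rw [key', ← mul_assoc, show i' + 2 * (j + 1) = i' + 2 + 2 * j by ring,
        S.e_mul_nest_of_ge j le_rfl, mul_assoc, key, ← mul_assoc, ← S.e_mul_nest_of_le j le_rfl,
        mul_assoc]

lemma capNest_mul_e_reflect {i i' p : ℕ} (j : ℕ) (h₁ : p + j ≤ i) (h₂ : i + 2 ≤ p + 2 * j)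
    (h : i + i' + 2 = 2 * (p + j)) : S.capNest j p * S.e i = S.capNest j p * S.e i' := by
  induction j generalizing p with
  | zero => omega
  | succ j ih =>
    rcases Nat.lt_or_ge i (p + 2 * j) with hi | hi
    · rw [capNest_succ_left, mul_assoc, mul_assoc, ih (by omega) (by omega) (by omega)]
    · obtain rfl : i = p + 2 * j := by omega
      obtain rfl : i' = p := by omega
      obtain ⟨j, rfl⟩ : ∃ j', j = j' + 1 := ⟨j - 1, by omega⟩
      have key : S.D i' * S.D (i' + 1) * S.e (i' + 2) = S.D i' * S.D (i' + 1) * S.e i' := by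
        rw [mul_assoc, mul_assoc, S.D_mul_e_succ, S.D_succ_mul_e, S.D_D i' i' le_rfl]
      have key' : S.capNest (j + 2) i' = S.D i' * S.D (i' + 1) * S.capNest j (i' + 2) := by
        rw [capNest_succ_left, capNest_succ_left, mul_assoc]
      rw [key', mul_assoc, mul_assoc _ _ (S.e i'), show i' + 2 * (j + 1) = i' + 2 + 2 * j by ring,
        S.capNest_mul_e_of_ge j le_rfl, ← mul_assoc, key, mul_assoc,
        S.capNest_mul_e_of_le j le_rfl]

/-! ### The half twist of two bundles modulo turnbacks -/

section Absorb

variable {S}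

lemma mul_g_of_mul_e {F : R} {i : ℕ} (A : k) (h : F * S.e i = 0) : F * S.g A i = A • F := by
  simp [g, mul_add, h]

lemma mul_row_of_mul_e {F : R} (A : k) (N p : ℕ)
    (h : ∀ i, p ≤ i → i < p + N → F * S.e i = 0) : F * S.row A N p = A ^ N • F := by
  induction N with
  | zero => simp [row]
  | succ N ih =>
    rw [row, ← mul_assoc, mul_g_of_mul_e A (h _ (by omega) (by omega)), smul_mul_assoc,
      ih fun i h₁ h₂ => h i h₁ (by omega), smul_smul, pow_succ']

lemma mul_col_of_mul_e {F : R} (A : k) (M p : ℕ)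
    (h : ∀ i, p ≤ i → i < p + M → F * S.e i = 0) : F * S.col A M p = A ^ M • F := by
  induction M with
  | zero => simp [col]
  | succ M ih =>
    rw [col, ← mul_assoc, ih fun i h₁ h₂ => h i h₁ (by omega), smul_mul_assoc,
      mul_g_of_mul_e A (h _ (by omega) (by omega)), smul_smul, pow_succ]

/-- The crossings of a strand with a bundle are absorbed between `F` and `t` if every turnback that
they can create is killed, also in the presence of a local element `T`. -/
lemma mul_row_mul {F t : R} {a b : ℕ} (A : k) (N p : ℕ) (ha : a ≤ p) (hb : p + N + 1 ≤ b)
    (h : ∀ T, S.Local a b T → ∀ i, p ≤ i → i < p + N → F * T * (S.e i * t) = 0)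
    {T : R} (hT : S.Local a b T) : F * T * (S.row A N p * t) = A ^ N • (F * T * t) := by
  induction N generalizing p with
  | zero => simp [row]
  | succ N ih =>
    have h₁ := ih (p + 1) (by omega) (by omega) fun T hT i h₁ h₂ => h T hT i (by omega) (by omega)
    have h₂ := h (T * S.row A N (p + 1))
      (hT.mul ((S.row_local A N (p + 1)).mono (by omega) (by omega))) p le_rfl (by omega)
    simp only [mul_assoc] at h₁ h₂ ⊢
    simp only [row_succ_right, g, add_mul, mul_add, mul_assoc, smul_mul_assoc, mul_smul_comm,
      one_mul, h₁, h₂, smul_zero, add_zero, smul_smul, pow_succ']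

lemma mul_col_mul {F t : R} {a b : ℕ} (A : k) (M p : ℕ) (ha : a ≤ p) (hb : p + M + 1 ≤ b)
    (h : ∀ T, S.Local a b T → ∀ i, p ≤ i → i < p + M → F * T * (S.e i * t) = 0)
    {T : R} (hT : S.Local a b T) : F * T * (S.col A M p * t) = A ^ M • (F * T * t) := by
  induction M with
  | zero => simp [col]
  | succ M ih =>
    have h₁ := ih (by omega) fun T hT i h₁ h₂ => h T hT i h₁ (by omega)
    have h₂ := h (T * S.col A M p)
      (hT.mul ((S.col_local A M p).mono (by omega) (by omega))) (p + M) (by omega) (by omega)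
    simp only [mul_assoc] at h₁ h₂ ⊢
    simp only [col, g, add_mul, mul_add, mul_assoc, smul_mul_assoc, mul_smul_comm,
      one_mul, h₁, h₂, smul_zero, add_zero, smul_smul, pow_succ']

end Absorb

/-- The pairs `i`, `i + 1` inside one of two bundles of `N` strands that start at position
`p`. -/
def InnerPair (p N i : ℕ) : Prop :=
  (p ≤ i ∧ i + 2 ≤ p + N) ∨ (p + N ≤ i ∧ i + 2 ≤ p + 2 * N)

/-- `F` kills every turnback that is inserted into one of two bundles of `N` strands starting at
position `p`. -/
def KillsInner (p N : ℕ) (F : R) : Prop := ∀ i, InnerPair p N i → F * S.e i = 0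

/-- Every hook glued to `t` inside one of two bundles of `N` strands starting at position `p`
slides along `t` to a place outside of these bundles where it is killed by `F`. -/
def SlidesOut (p N : ℕ) (F t : R) : Prop :=
  ∀ i, InnerPair p N i →
    ∃ i', (i' + 2 ≤ p ∨ p + 2 * N ≤ i') ∧ F * S.e i' = 0 ∧ S.e i * t = S.e i' * t

/-- The coefficients in the expansion of the half twist of two bundles of `N` strands modulo
turnbacks. -/
def halfTwistCoeff (A : k) : ℕ → ℕ → k
  | 0, 0 => 1
  | 0, _ + 1 => 0
  | N + 1, 0 => A⁻¹ ^ (2 * N + 1) * halfTwistCoeff A N 0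
  | N + 1, j + 1 =>
    A ^ (2 * N + 1) * halfTwistCoeff A N j + A⁻¹ ^ (2 * N + 1) * halfTwistCoeff A N (j + 1)

lemma halfTwistCoeff_of_lt (A : k) {N j : ℕ} (h : N < j) : halfTwistCoeff A N j = 0 := by
  induction N generalizing j with
  | zero => obtain ⟨j, rfl⟩ : ∃ j', j = j' + 1 := ⟨j - 1, by omega⟩; rfl
  | succ N ih =>
    obtain ⟨j, rfl⟩ : ∃ j', j = j' + 1 := ⟨j - 1, by omega⟩
    rw [halfTwistCoeff, ih (by omega), ih (by omega)]; simp

variable {S} in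
lemma KillsInner.mul_U {p N : ℕ} {F : R} (h : S.KillsInner p (N + 1) F) :
    S.KillsInner p N (F * S.U (p + N)) := by
  rintro i (⟨h₁, h₂⟩ | ⟨h₁, h₂⟩)
  · rw [mul_assoc, ← S.e_mul_U_of_le (by omega), ← mul_assoc, h i (.inl (by omega)), zero_mul]
  · rw [mul_assoc, ← S.e_mul_U_of_ge (by omega), ← mul_assoc, h (i + 2) (.inr (by omega)),
      zero_mul]

variable {S} in
lemma SlidesOut.mul_U {p N : ℕ} {F t : R} (h : S.SlidesOut p (N + 1) F t) :
    S.SlidesOut p N (F * S.U (p + N)) (S.D (p + N) * t) := by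
  intro i hi
  -- The pair in the larger bundles that `D (p + N)` turns into the pair `i`, `i + 1`.
  obtain ⟨l, hl, hD⟩ : ∃ l, InnerPair p (N + 1) l ∧
      S.D (p + N) * S.e l = S.e i * S.D (p + N) := by
    rcases hi with ⟨h₁, h₂⟩ | ⟨h₁, h₂⟩
    · exact ⟨i, .inl (by omega), S.D_mul_e_of_le (by omega)⟩
    · exact ⟨i + 2, .inr (by omega), S.D_mul_e_of_ge (by omega)⟩
  obtain ⟨i', hi', hF, ht⟩ := h l hl
  rw [← mul_assoc, ← hD, mul_assoc, ht]
  rcases hi' with hi' | hi'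
  · refine ⟨i', .inl hi', ?_, ?_⟩
    · rw [mul_assoc, ← S.e_mul_U_of_le (by omega), ← mul_assoc, hF, zero_mul]
    · rw [← mul_assoc, S.D_mul_e_of_le (by omega), mul_assoc]
  · obtain ⟨m, rfl⟩ : ∃ m, i' = m + 2 := ⟨i' - 2, by omega⟩
    refine ⟨m, .inr (by omega), ?_, ?_⟩
    · rw [mul_assoc, ← S.e_mul_U_of_ge (by omega), ← mul_assoc, hF, zero_mul]
    · rw [← mul_assoc, S.D_mul_e_of_ge (by omega), mul_assoc]

variable {S} in
lemma SlidesOut.mul_local_mul {p N : ℕ} {F t T : R} (h : S.SlidesOut p N F t)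
    (hT : S.Local p (p + 2 * N) T) {i : ℕ} (hi : InnerPair p N i) :
    F * T * (S.e i * t) = 0 := by
  obtain ⟨i', hi', hF, ht⟩ := h i hi
  rw [ht, ← mul_assoc, mul_assoc F, (hT i' hi').eq, ← mul_assoc, hF, zero_mul, zero_mul]

section Twist

variable {A : k} (hA : A ≠ 0) (h2 : S.loop = -(A ^ 2 + A⁻¹ ^ 2))
include hA h2

/-- The curl formula for bundles: the arc between the bundles, after being pulled through the
crossing of the remaining strands, crosses only strands of its own bundles. -/
lemma mul_bundleCross_mul_col_mul_row_mul_U {N p : ℕ} {F : R} (hF : S.KillsInner p (N + 1) F) :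
    F * S.bundleCross A N N (p + 1) * S.col A N p * S.row A N (p + N + 1) * S.U (p + N) =
      A⁻¹ ^ (2 * N) • (F * S.U (p + N) * S.bundleCross A N N p) := by
  have h := congrArg (F * ·) (S.bundleCross_mul_U hA h2 N p)
  simp only [← mul_assoc] at h
  rw [h, mul_col_of_mul_e A⁻¹ N p fun i h₁ h₂ => hF i (.inl (by omega)), smul_mul_assoc,
    mul_row_of_mul_e A⁻¹ N _ fun i h₁ h₂ => hF i (.inr (by omega))]
  simp only [smul_mul_assoc, smul_smul, two_mul, pow_add]

lemma mul_bundleCross_mul_U {N p : ℕ} {F : R} (hF : S.KillsInner p (N + 1) F) :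
    F * S.bundleCross A (N + 1) (N + 1) p * S.U (p + N) =
      (-A⁻¹ ^ (2 * N + 3)) • (F * S.U (p + N) * S.bundleCross A N N p) := by
  rw [bundleCross_succ_succ, mul_assoc, mul_assoc _ (S.g A _), S.g_mul_U_self hA h2,
    mul_smul_comm, mul_smul_comm]
  simp only [← mul_assoc]
  rw [S.mul_bundleCross_mul_col_mul_row_mul_U hA h2 hF, smul_smul]
  congr 1
  ring

/-- A nest of `j` arcs between two bundles is pulled through their crossing; each arc contributes
a curl. -/
lemma mul_bundleCross_mul_nest (N j p : ℕ) {F : R} (hF : S.KillsInner p (N + j) F) :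
    F * S.bundleCross A (N + j) (N + j) p * S.nest j (p + N) =
      (∏ i ∈ Finset.range j, -A⁻¹ ^ (2 * (N + i) + 3)) •
        (F * S.nest j (p + N) * S.bundleCross A N N p) := by
  induction j generalizing F with
  | zero => simp [nest]
  | succ j ih =>
    have hF' : S.KillsInner p (N + j + 1) F := hF
    rw [nest, ← mul_assoc, ← add_assoc N j 1, add_assoc p N j,
      S.mul_bundleCross_mul_U hA h2 hF', smul_mul_assoc, ih hF'.mul_U, smul_smul,
      Finset.prod_range_succ, mul_comm (Finset.prod _ _)]
    simp only [mul_assoc]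

/-- Expansion of the half twist of two bundles of `N` strands modulo turnbacks: the innermost
crossing is resolved, and in both resolutions the remaining crossings of the two strands concerned
are absorbed. -/
theorem mul_bundleCross_mul (N p : ℕ) {F t : R} (hF : S.KillsInner p N F)
    (ht : S.SlidesOut p N F t) :
    F * S.bundleCross A N N p * t = ∑ j ∈ Finset.range (N + 1),
      halfTwistCoeff A N j • (F * S.nest (N - j) (p + j) * (S.capNest (N - j) (p + j) * t)) := by
  induction N generalizing p F t with
  | zero => simp [bundleCross, halfTwistCoeff, nest, capNest]
  | succ N ih =>
    have hF₁ : S.KillsInner (p + 1) N F := by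
      rintro i (⟨h₁, h₂⟩ | ⟨h₁, h₂⟩)
      · exact hF i (.inl (by omega))
      · exact hF i (.inr (by omega))
    have ht₁ : S.SlidesOut (p + 1) N F t := by
      intro i hi
      obtain ⟨i', hi', h⟩ := ht i (by rcases hi with hi | hi <;> [left; right] <;> omega)
      exact ⟨i', by omega, h⟩
    have ih₁ := ih (p + 1) hF₁ ht₁
    have ih₂ := ih p hF.mul_U ht.mul_U
    set Z : ℕ → R := fun j =>
      F * S.nest (N + 1 - j) (p + j) * (S.capNest (N + 1 - j) (p + j) * t) with hZ
    have e₁ : F * S.bundleCross A N N (p + 1) * t =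
        ∑ j ∈ Finset.range (N + 1), halfTwistCoeff A N j • Z (j + 1) := by
      rw [ih₁]
      refine Finset.sum_congr rfl fun j hj => ?_
      simp only [hZ, Nat.add_sub_add_right, show p + 1 + j = p + (j + 1) by ring]
    have e₂ : F * S.U (p + N) * S.bundleCross A N N p * (S.D (p + N) * t) =
        ∑ j ∈ Finset.range (N + 1), halfTwistCoeff A N j • Z j := by
      rw [ih₂]
      refine Finset.sum_congr rfl fun j hj => ?_
      have hj' : N + 1 - j = N - j + 1 := by have := Finset.mem_range.1 hj; omega
      have hj'' : p + j + (N - j) = p + N := by have := Finset.mem_range.1 hj; omega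
      simp only [hZ, hj', nest, capNest, hj'', mul_assoc]
    have e₃ : F * S.bundleCross A N N (p + 1) * S.col A N p * S.row A N (p + N + 1) * t =
        A ^ (2 * N) • (F * S.bundleCross A N N (p + 1) * t) := by
      have hX : S.Local p (p + 2 * (N + 1)) (S.bundleCross A N N (p + 1)) :=
        (S.bundleCross_local A N N (p + 1)).mono (by omega) (by omega)
      have hc : S.Local p (p + 2 * (N + 1)) (S.col A N p) :=
        (S.col_local A N p).mono le_rfl (by omega)
      have h₁ := mul_row_mul (S := S) (F := F) (t := t) A N (p + N + 1) (a := p)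
        (b := p + 2 * (N + 1)) (by omega) (by omega)
        (fun T hT i h₁ h₂ => ht.mul_local_mul hT (.inr (by omega))) (hX.mul hc)
      have h₂ := mul_col_mul (S := S) (F := F) (t := t) A N p (a := p)
        (b := p + 2 * (N + 1)) (by omega) (by omega)
        (fun T hT i h₁ h₂ => ht.mul_local_mul hT (.inl (by omega))) hX
      simp only [mul_assoc] at h₁ h₂ ⊢
      rw [h₁, h₂, smul_smul, two_mul, pow_add]
    have e₄ := S.mul_bundleCross_mul_col_mul_row_mul_U hA h2 hF
    have e₅ : F * S.bundleCross A (N + 1) (N + 1) p * t =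
        A ^ (2 * N + 1) • (F * S.bundleCross A N N (p + 1) * t) + A⁻¹ ^ (2 * N + 1) •
          (F * S.U (p + N) * S.bundleCross A N N p * (S.D (p + N) * t)) := by
      calc _ = A • (F * S.bundleCross A N N (p + 1) * S.col A N p * S.row A N (p + N + 1) * t) +
            A⁻¹ • (F * S.bundleCross A N N (p + 1) * S.col A N p * S.row A N (p + N + 1) *
              S.U (p + N) * (S.D (p + N) * t)) := by
            simp only [bundleCross_succ_succ, g, e, mul_add, add_mul, mul_smul_comm,
              smul_mul_assoc, mul_one, mul_assoc]
        _ = _ := by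
            rw [e₃, e₄]
            simp only [smul_mul_assoc, smul_smul, ← pow_succ']
    change _ = ∑ j ∈ Finset.range (N + 1 + 1), halfTwistCoeff A (N + 1) j • Z j
    clear_value Z
    rw [e₅, e₁, e₂, Finset.sum_range_succ' _ (N + 1),
      Finset.sum_range_succ' (fun j => halfTwistCoeff A N j • Z j) N]
    simp only [halfTwistCoeff, add_smul, Finset.sum_add_distrib, mul_smul, ← Finset.smul_sum]
    rw [Finset.sum_range_succ (fun j => halfTwistCoeff A N (j + 1) • Z (j + 1)) N,
      halfTwistCoeff_of_lt A (Nat.lt_succ_self N), zero_smul, add_zero, smul_add, add_assoc]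

end Twist

/-! ### Coefficients of half twists and full twists -/

/-- The `q`-Pochhammer symbol `(q)_N`. -/
def qPoch (q : k) (N : ℕ) : k := ∏ l ∈ Finset.range N, (1 - q ^ (l + 1))

lemma qPoch_succ (q : k) (N : ℕ) : qPoch q (N + 1) = qPoch q N * (1 - q ^ (N + 1)) :=
  Finset.prod_range_succ _ _

lemma qPoch_ne_zero {q : k} (hq : ∀ l : ℕ, q ^ (l + 1) ≠ 1) (N : ℕ) : qPoch q N ≠ 0 :=
  Finset.prod_ne_zero_iff.2 fun l _ => sub_ne_zero.2 (hq l).symm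

/-- Up to a power of `A`, the coefficients of the half twist are Gaussian binomial
coefficients in `A ^ 4`. -/
lemma halfTwistCoeff_mul_qPoch {A : k} (hA : A ≠ 0) (j i : ℕ) :
    halfTwistCoeff A (j + i) j * (qPoch (A ^ 4) j * qPoch (A ^ 4) i) * A ^ ((j + i) ^ 2) =
      A ^ (2 * j ^ 2) * qPoch (A ^ 4) (j + i) := by
  obtain ⟨N, hN⟩ : ∃ N, N = j + i := ⟨_, rfl⟩
  induction N generalizing i j with
  | zero =>
    obtain rfl : j = 0 := by omega
    obtain rfl : i = 0 := by omega
    simp [halfTwistCoeff, qPoch]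
  | succ N ih =>
    rcases j with _ | j
    · obtain rfl : i = N + 1 := by omega
      have h := ih 0 N (by omega)
      simp only [zero_add] at h ⊢
      rw [halfTwistCoeff, qPoch_succ]
      calc _ = A⁻¹ ^ (2 * N + 1) * A ^ (2 * N + 1) * (1 - (A ^ 4) ^ (N + 1)) *
            (halfTwistCoeff A N 0 * (qPoch (A ^ 4) 0 * qPoch (A ^ 4) N) * A ^ N ^ 2) := by ring
        _ = _ := by
            rw [h, inv_pow, inv_mul_cancel₀ (pow_ne_zero _ hA)]
            ring
    rcases i with _ | i
    · obtain rfl : N = j := by omega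
      have h := ih N 0 (by omega)
      simp only [add_zero] at h ⊢
      rw [halfTwistCoeff, halfTwistCoeff_of_lt A (Nat.lt_succ_self N), qPoch_succ]
      calc _ = A ^ (2 * N + 1) * A ^ (2 * N + 1) * (1 - (A ^ 4) ^ (N + 1)) *
            (halfTwistCoeff A N N * (qPoch (A ^ 4) N * qPoch (A ^ 4) 0) * A ^ N ^ 2) := by ring
        _ = _ := by rw [h]; ring
    obtain rfl : N = j + i + 1 := by omega
    have h₁ := ih j (i + 1) (by omega)
    have h₂ := ih (j + 1) i (by omega)
    rw [show j + (i + 1) = j + i + 1 by ring] at h₁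
    rw [show j + 1 + i = j + i + 1 by ring] at h₂
    rw [show j + 1 + (i + 1) = j + i + 1 + 1 by ring, halfTwistCoeff, qPoch_succ _ (j + i + 1)]
    rw [qPoch_succ _ i] at h₁ ⊢
    rw [qPoch_succ _ j] at h₂ ⊢
    set N := j + i + 1
    have hN' : (N : ℕ) = j + i + 1 := rfl
    have hinv : A⁻¹ ^ (2 * N + 1) * A ^ (2 * N + 1) = 1 := by
      rw [inv_pow, inv_mul_cancel₀ (pow_ne_zero _ hA)]
    calc _ = A ^ (2 * N + 1) * A ^ (2 * N + 1) * (1 - (A ^ 4) ^ (j + 1)) *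
            (halfTwistCoeff A N j * (qPoch (A ^ 4) j * (qPoch (A ^ 4) i * (1 - (A ^ 4) ^ (i + 1))))
              * A ^ N ^ 2) + A⁻¹ ^ (2 * N + 1) * A ^ (2 * N + 1) * (1 - (A ^ 4) ^ (i + 1)) *
            (halfTwistCoeff A N (j + 1) * (qPoch (A ^ 4) j * (1 - (A ^ 4) ^ (j + 1)) *
              qPoch (A ^ 4) i) * A ^ N ^ 2) := by ring
      _ = _ := by
        rw [h₁, h₂, hinv, hN']
        ring

/-- The `q`-binomial theorem. -/
lemma sum_halfTwistCoeff_mul_pow (A w : k) (M : ℕ) :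
    ∑ i ∈ Finset.range (M + 1), halfTwistCoeff A M i * w ^ i =
      ∏ l ∈ Finset.range M, (A⁻¹ ^ (2 * l + 1) + A ^ (2 * l + 1) * w) := by
  induction M with
  | zero => simp [halfTwistCoeff]
  | succ M ih =>
    rw [Finset.prod_range_succ, ← ih, Finset.sum_range_succ', mul_add]
    nth_rw 2 [Finset.sum_range_succ']
    simp only [halfTwistCoeff, add_mul, Finset.sum_add_distrib]
    rw [Finset.sum_range_succ (fun i => A⁻¹ ^ (2 * M + 1) * halfTwistCoeff A M (i + 1) * _),
      halfTwistCoeff_of_lt A (Nat.lt_succ_self M), Finset.sum_mul, Finset.sum_mul]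
    have h₁ : ∀ i, A ^ (2 * M + 1) * halfTwistCoeff A M i * w ^ (i + 1) =
      halfTwistCoeff A M i * w ^ i * (A ^ (2 * M + 1) * w) := fun i => by ring
    have h₂ : ∀ i, A⁻¹ ^ (2 * M + 1) * halfTwistCoeff A M (i + 1) * w ^ (i + 1) =
      halfTwistCoeff A M (i + 1) * w ^ (i + 1) * A⁻¹ ^ (2 * M + 1) := fun i => by ring
    simp only [h₁, h₂]
    ring

/-- The factor for pulling `j` nested arcs through a half twist. -/
def curlCoeff (A : k) (K j : ℕ) : k := ∏ i ∈ Finset.range j, -A⁻¹ ^ (2 * (K + i) + 3)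

lemma curlCoeff_eq (A : k) (K j : ℕ) :
    curlCoeff A K j = (-1) ^ j * A⁻¹ ^ (j ^ 2 + 2 * K * j + 2 * j) := by
  induction j with
  | zero => simp [curlCoeff]
  | succ j ih =>
    rw [curlCoeff, Finset.prod_range_succ, ← curlCoeff, ih]
    ring

/-- The coefficients of a full twist of two bundles of `n` strands, of which `n - N` are turned
back, in terms of the diagrams with `n - j` turned back strands. They are normalized by the
framing factor, which makes them independent of `n`. -/
def fullTwistCoeff (A : k) (N j : ℕ) : k :=
  (-1) ^ (N - j) * A ^ (2 * (N - j)) * A ^ (4 * (j ^ 2 + j)) *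
    (qPoch (A ^ 4) N / qPoch (A ^ 4) j) *
      (qPoch (A ^ 4) N / (qPoch (A ^ 4) j * qPoch (A ^ 4) (N - j)))

lemma prod_eq_qPoch_div {A : k} (hA : A ≠ 0) (hq : ∀ l : ℕ, (A ^ 4) ^ (l + 1) ≠ 1) (j M : ℕ) :
    ∏ l ∈ Finset.range M, (A⁻¹ ^ (2 * l + 1) + A ^ (2 * l + 1) * -A ^ (4 * j + 2)) =
      A⁻¹ ^ M ^ 2 * (qPoch (A ^ 4) (j + M) / qPoch (A ^ 4) j) := by
  have h0 := qPoch_ne_zero hq j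
  induction M with
  | zero => simp [h0]
  | succ M ih =>
    have hinv : A⁻¹ ^ (2 * M + 1) * A ^ (2 * M + 1) = 1 := by
      rw [inv_pow, inv_mul_cancel₀ (pow_ne_zero _ hA)]
    rw [Finset.prod_range_succ, ih, ← add_assoc, qPoch_succ]
    calc _ = A⁻¹ ^ M ^ 2 * (qPoch (A ^ 4) (j + M) / qPoch (A ^ 4) j) *
          (A⁻¹ ^ (2 * M + 1) - A⁻¹ ^ (2 * M + 1) * A ^ (2 * M + 1) *
            (A ^ (2 * M + 1) * A ^ (4 * j + 2))) := by rw [hinv]; ring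
      _ = A⁻¹ ^ M ^ 2 * (qPoch (A ^ 4) (j + M) / qPoch (A ^ 4) j) *
          A⁻¹ ^ (2 * M + 1) * (1 - (A ^ 4) ^ (j + M + 1)) := by ring
      _ = _ := by ring

/-- The matrix of the full twist is the square of the matrix of the half twist. -/
lemma sum_curlCoeff_mul_halfTwistCoeff {A : k} (hA : A ≠ 0)
    (hq : ∀ l : ℕ, (A ^ 4) ^ (l + 1) ≠ 1) {n N j : ℕ} (hN : N ≤ n) (hj : j ≤ N) :
    A ^ (2 * (n ^ 2 + 2 * n)) * ∑ i ∈ Finset.range (N + 1),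
      (curlCoeff A N (n - N) * halfTwistCoeff A N i) *
        (curlCoeff A i (n - i) * halfTwistCoeff A i j) = fullTwistCoeff A N j := by
  obtain ⟨M, rfl⟩ := Nat.exists_eq_add_of_le hj
  obtain ⟨d, rfl⟩ := Nat.exists_eq_add_of_le hN
  rw [add_assoc j M 1, Finset.sum_range_add, Finset.sum_eq_zero (s := Finset.range j), zero_add]
  swap
  · intro i hi
    rw [halfTwistCoeff_of_lt A (Finset.mem_range.1 hi)]; simp
  have hj0 := qPoch_ne_zero hq j
  have hM0 := qPoch_ne_zero hq M
  have hN0 := qPoch_ne_zero hq (j + M)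
  set b := qPoch (A ^ 4) (j + M) / (qPoch (A ^ 4) j * qPoch (A ^ 4) M) with hb
  have hterm : ∀ i ∈ Finset.range (M + 1),
      A ^ (2 * ((j + M + d) ^ 2 + 2 * (j + M + d))) *
        ((curlCoeff A (j + M) (j + M + d - (j + M)) * halfTwistCoeff A (j + M) (j + i)) *
        (curlCoeff A (j + i) (j + M + d - (j + i)) * halfTwistCoeff A (j + i) j)) =
      (-1) ^ M * b * A ^ (2 * (j + M) + 4 * j ^ 2 + 2 * j + M ^ 2) *
        (halfTwistCoeff A M i * (-A ^ (4 * j + 2)) ^ i) := by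
    intro i hi
    obtain ⟨r, rfl⟩ := Nat.exists_eq_add_of_le (Nat.lt_succ_iff.1 (Finset.mem_range.1 hi))
    have hi0 := qPoch_ne_zero hq i
    have hr0 := qPoch_ne_zero hq r
    have hji0 := qPoch_ne_zero hq (j + i)
    have h₁ := halfTwistCoeff_mul_qPoch hA (j + i) r
    have h₂ := halfTwistCoeff_mul_qPoch hA j i
    have h₃ := halfTwistCoeff_mul_qPoch hA i r
    rw [← eq_div_iff (pow_ne_zero _ hA), ← eq_div_iff (mul_ne_zero (by assumption) (by assumption))]
      at h₁ h₂ h₃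
    rw [show j + (i + r) + d - (j + (i + r)) = d by omega,
      show j + (i + r) + d - (j + i) = r + d by omega, show j + (i + r) = j + i + r by ring,
      curlCoeff_eq, curlCoeff_eq, h₁, h₂, h₃, hb, show j + (i + r) = j + i + r by ring]
    have hs : (-1 : k) ^ d * (-1) ^ (r + d) = (-1) ^ (i + r) * (-1) ^ i := by
      rw [← pow_add, ← pow_add, show d + (r + d) = r + 2 * d by ring,
        show i + r + i = r + 2 * i by ring, pow_add, pow_mul, pow_add _ _ (2 * i), pow_mul]
      simp
    rw [neg_pow (A ^ (4 * j + 2)) i]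
    have hc : ∀ m, A⁻¹ ^ m * A ^ m = 1 := fun m => by
      rw [inv_pow, inv_mul_cancel₀ (pow_ne_zero _ hA)]
    -- The framing factor cancels the negative powers of `A` from both curls.
    have hA' : A ^ (2 * ((j + i + r + d) ^ 2 + 2 * (j + i + r + d))) *
        A⁻¹ ^ (d ^ 2 + 2 * (j + i + r) * d + 2 * d) *
        A⁻¹ ^ ((r + d) ^ 2 + 2 * (j + i) * (r + d) + 2 * (r + d)) =
        A ^ ((j + i + r) ^ 2 + 2 * (j + i + r) + (j + i) ^ 2 + 2 * (j + i)) := by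
      calc _ = A ^ ((j + i + r) ^ 2 + 2 * (j + i + r) + (j + i) ^ 2 + 2 * (j + i)) *
          (A⁻¹ ^ (d ^ 2 + 2 * (j + i + r) * d + 2 * d) *
            A ^ (d ^ 2 + 2 * (j + i + r) * d + 2 * d)) *
          (A⁻¹ ^ ((r + d) ^ 2 + 2 * (j + i) * (r + d) + 2 * (r + d)) *
            A ^ ((r + d) ^ 2 + 2 * (j + i) * (r + d) + 2 * (r + d))) := by ring
        _ = _ := by rw [hc, hc, mul_one, mul_one]
    calc _ = (A ^ (2 * ((j + i + r + d) ^ 2 + 2 * (j + i + r + d))) *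
        A⁻¹ ^ (d ^ 2 + 2 * (j + i + r) * d + 2 * d) *
        A⁻¹ ^ ((r + d) ^ 2 + 2 * (j + i) * (r + d) + 2 * (r + d))) *
        ((-1 : k) ^ d * (-1) ^ (r + d)) *
        (A ^ (2 * (j + i) ^ 2) * qPoch (A ^ 4) (j + i + r) / A ^ (j + i + r) ^ 2 /
          (qPoch (A ^ 4) (j + i) * qPoch (A ^ 4) r) *
        (A ^ (2 * j ^ 2) * qPoch (A ^ 4) (j + i) / A ^ (j + i) ^ 2 /
          (qPoch (A ^ 4) j * qPoch (A ^ 4) i))) := by ring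
      _ = _ := by
        rw [hA', hs]
        field_simp
        ring
  rw [Finset.mul_sum, Finset.sum_congr rfl hterm, ← Finset.mul_sum, sum_halfTwistCoeff_mul_pow,
    prod_eq_qPoch_div hA hq, fullTwistCoeff, Nat.add_sub_cancel_left]
  have hinv : A ^ M ^ 2 * A⁻¹ ^ M ^ 2 = 1 := by
    rw [inv_pow, mul_inv_cancel₀ (pow_ne_zero _ hA)]
  calc _ = (A ^ M ^ 2 * A⁻¹ ^ M ^ 2) * ((-1) ^ M * b * A ^ (2 * (j + M) + 4 * j ^ 2 + 2 * j) *
        (qPoch (A ^ 4) (j + M) / qPoch (A ^ 4) j)) := by ring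
    _ = _ := by rw [hinv, hb]; ring

/-! ### Planar states of four bundles -/

/-- The position of the first strand of the two twisted bundles: the middle ones or the lower
ones of four bundles of `n` strands. -/
def twistPos (n : ℕ) (b : Bool) : ℕ := if b then n else 2 * n

/-- The arcs between four bundles, before arcs `⊂` between the two bundles to be twisted are
inserted. Of these bundles, each has `K` strands, the other two have `n`.
If the middle bundles are to be twisted, there are `n - K` outer arcs and `K` arcs on either side;
if the lower bundles are to be twisted, there are `K` arcs from the first to the last,
`n - K` from the first to the second, and `K` from the second to the third bundle. -/
def planarBase (n : ℕ) : Bool → ℕ → R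
  | true, K => S.nest K (n + K) * S.nest K (n - K) * S.nest (n - K) 0
  | false, K => S.nest K (2 * n - K) * S.nest (n - K) K * S.nest K 0

/-- The crossingless diagram of four bundles of `n` strands in which `n - K` arcs join the two
bundles to be twisted. -/
def planarState (n : ℕ) (b : Bool) (K : ℕ) : R :=
  S.nest (n - K) (twistPos n b + K) * S.planarBase n b K

/-- Joining the two innermost of the `2 (K + 1)` strands that lead to the twisted bundles. -/
lemma D_mul_planarBase {n K : ℕ} (b : Bool) (h : K < n) :
    S.D (twistPos n b + K) * S.planarBase n b (K + 1) = S.planarBase n b K := by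
  obtain ⟨m, rfl⟩ := Nat.exists_eq_add_of_lt h
  cases b
  · have h₁ := S.D_mul_nest_of_ge (i := K + m + 1 + (m + 1)) (p := K + m + 1 + (m + 1)) K le_rfl
    simp only [twistPos, planarBase, Bool.false_eq_true, if_false]
    rw [show 2 * (K + m + 1) - (K + 1) = K + m + 1 + m by omega,
      show 2 * (K + m + 1) - K = K + m + 1 + m + 1 by omega, show K + m + 1 - (K + 1) = m by omega,
      show K + m + 1 - K = m + 1 by omega,
      show 2 * (K + m + 1) + K = K + m + 1 + (m + 1) + 2 * K by ring, nest_succ_right,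
      S.nest_succ_right m]
    simp only [← mul_assoc]
    rw [show K + m + 1 + m + 1 = K + m + 1 + (m + 1) by ring, h₁, mul_assoc _ (S.D _),
      show K + m + 1 + (m + 1) = K + m + 1 + m + 1 by ring, S.D_succ_U, mul_one, nest]
    simp [mul_assoc]
  · have h₁ := S.D_mul_nest_of_le (i := K + m + 1 + K) (p := K + m + 1 + K + 2) K le_rfl
    simp only [twistPos, planarBase, if_true]
    rw [show K + m + 1 - (K + 1) = m by omega, show K + m + 1 - K = m + 1 by omega,
      nest_succ_right, show K + m + 1 + (K + 1) = K + m + 1 + K + 1 by ring]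
    simp only [← mul_assoc]
    rw [h₁, mul_assoc _ (S.D _), S.D_U_succ, mul_one, Nat.add_sub_cancel,
      S.nest_succ_right K m, nest]
    simp [mul_assoc]

lemma capNest_mul_planarBase {n K : ℕ} (b : Bool) (j : ℕ) (h : K + j ≤ n) :
    S.capNest j (twistPos n b + K) * S.planarBase n b (K + j) = S.planarBase n b K := by
  induction j with
  | zero => simp [capNest]
  | succ j ih =>
    rw [capNest, mul_assoc, add_assoc, ← add_assoc K, S.D_mul_planarBase b (by omega),
      ih (by omega)]

/-- The two families of planar states coincide: if `n - K` arcs join the middle bundles, then `K`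
arcs join the lower ones. -/
lemma planarState_not {n K : ℕ} (b : Bool) (h : K ≤ n) :
    S.planarState n (!b) (n - K) = S.planarState n b K := by
  have key : ∀ K ≤ n, S.planarState n false (n - K) = S.planarState n true K := by
    intro K h
    obtain ⟨m, rfl⟩ := Nat.exists_eq_add_of_le h
    have h₁ := S.nest_mul_nest (p := K + m + K) (q := K + m + K) m K le_rfl
    simp only [planarState, planarBase, twistPos, Bool.false_eq_true, if_false, if_true]
    rw [show K + m - (K + m - K) = K by omega, show K + m - K = m by omega,
      show 2 * (K + m) - m = K + m + K by omega, show 2 * (K + m) + m = K + m + K + 2 * m by ring]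
    simp only [← mul_assoc]
    rw [h₁]
  cases b
  · have := key (n - K) (by omega)
    rw [Nat.sub_sub_self h] at this
    exact this.symm
  · exact key K h

/-- The pairs `i`, `i + 1` inside one of four bundles of `n` strands. -/
def BundlePair (n i : ℕ) : Prop :=
  i + 2 ≤ n ∨ (n ≤ i ∧ i + 2 ≤ 2 * n) ∨ (2 * n ≤ i ∧ i + 2 ≤ 3 * n) ∨
    (3 * n ≤ i ∧ i + 2 ≤ 4 * n)

/-- `F` kills every turnback in one of four bundles of `n` strands. -/
def KillsTurnbacks (n : ℕ) (F : R) : Prop := ∀ i, BundlePair n i → F * S.e i = 0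

variable {S}

lemma KillsTurnbacks.killsInner {n : ℕ} {F : R} (hF : S.KillsTurnbacks n F) (b : Bool) :
    S.KillsInner (twistPos n b) n F := by
  intro i hi
  refine hF i ?_
  cases b <;> simp only [twistPos, InnerPair, BundlePair, if_true, if_false, Bool.false_eq_true]
    at hi ⊢ <;> omega

lemma KillsInner.mul_nest {p N : ℕ} (j : ℕ) {F : R} (h : S.KillsInner p (N + j) F) :
    S.KillsInner p N (F * S.nest j (p + N)) := by
  induction j generalizing F with
  | zero => simpa [nest] using h
  | succ j ih =>
    have h' : S.KillsInner p (N + j + 1) F := h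
    rw [nest, ← mul_assoc, add_assoc]
    exact ih h'.mul_U

/-- Hooks on the upper one of the twisted bundles slide along the arcs of a planar state to the
bundle above. -/
lemma e_mul_planarBase {n K i i' : ℕ} (b : Bool) (hK : K ≤ n) (h₁ : twistPos n b ≤ i)
    (h₂ : i + 2 ≤ twistPos n b + K) (h : i + i' + 2 = 2 * twistPos n b) :
    S.e i * S.planarBase n b K = S.e i' * S.planarBase n b K := by
  obtain ⟨m, rfl⟩ := Nat.exists_eq_add_of_le hK
  cases b <;> simp only [planarBase, Nat.add_sub_cancel_left, twistPos, if_true, if_false,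
    Bool.false_eq_true] at h₁ h₂ h ⊢
  · rw [mul_assoc, ← mul_assoc (S.e i), ← mul_assoc (S.e _),
      S.e_mul_nest_reflect K (i' := i') (by omega) (by omega) (by omega)]
  · have hr : S.e i * S.nest K m = S.e i' * S.nest K m :=
      S.e_mul_nest_reflect K (by omega) (by omega) (by omega)
    rw [mul_assoc, ← mul_assoc, S.e_mul_nest_of_le K (by omega), mul_assoc,
      ← mul_assoc (S.e i), hr, mul_assoc, ← mul_assoc, ← S.e_mul_nest_of_le K (by omega),
      mul_assoc]

/-- Hooks on the twisted bundles slide along the arcs of a planar state to the neighboring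
bundles. -/
lemma KillsTurnbacks.slidesOut {n K : ℕ} {F : R} (hF : S.KillsTurnbacks n F) (b : Bool)
    (hK : K ≤ n) :
    S.SlidesOut (twistPos n b) K (F * S.nest (n - K) (twistPos n b + K)) (S.planarBase n b K) := by
  obtain ⟨m, rfl⟩ := Nat.exists_eq_add_of_le hK
  have up : ∀ i', i' + 2 ≤ twistPos (K + m) b → BundlePair (K + m) i' →
      F * S.nest m (twistPos (K + m) b + K) * S.e i' = 0 := by
    intro i' h h'
    rw [mul_assoc, ← S.e_mul_nest_of_le _ (by omega), ← mul_assoc, hF _ h', zero_mul]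
  have low : ∀ i', twistPos (K + m) b + K ≤ i' → BundlePair (K + m) (i' + 2 * m) →
      F * S.nest m (twistPos (K + m) b + K) * S.e i' = 0 := by
    intro i' h h'
    rw [mul_assoc, ← S.e_mul_nest_of_ge _ h, ← mul_assoc, hF _ h', zero_mul]
  rw [Nat.add_sub_cancel_left]
  rintro i (⟨h₁, h₂⟩ | ⟨h₁, h₂⟩)
  · have hp : twistPos (K + m) b = K + m ∨ twistPos (K + m) b = 2 * (K + m) := by
      cases b <;> simp [twistPos]
    refine ⟨2 * twistPos (K + m) b - 2 - i, .inl (by omega), up _ (by omega) ?_,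
      e_mul_planarBase b hK h₁ h₂ (by omega)⟩
    unfold BundlePair; omega
  cases b <;> simp only [planarBase, Nat.add_sub_cancel_left, twistPos, if_true, if_false,
    Bool.false_eq_true] at up low h₁ h₂ ⊢
  · rw [show 2 * (K + m) - K = 2 * m + K by omega]
    obtain ⟨r, rfl⟩ : ∃ r, i = r + 2 * m + 2 * K := ⟨i - (2 * m + 2 * K), by omega⟩
    have hr : S.e r * S.nest K 0 = S.e (2 * K - 2 - r) * S.nest K 0 :=
      S.e_mul_nest_reflect K (by omega) (by omega) (by omega)
    refine ⟨2 * K - 2 - r, .inl (by omega), up _ (by omega) ?_, ?_⟩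
    · unfold BundlePair; omega
    · calc S.e (r + 2 * m + 2 * K) * (S.nest K (2 * m + K) * S.nest m K * S.nest K 0)
          = S.nest K (2 * m + K) * (S.nest m K * (S.e r * S.nest K 0)) := by
            rw [mul_assoc, ← mul_assoc, S.e_mul_nest_of_ge K (by omega), mul_assoc,
              ← mul_assoc (S.e _), S.e_mul_nest_of_ge m (by omega), mul_assoc]
        _ = S.e (2 * K - 2 - r) * (S.nest K (2 * m + K) * S.nest m K * S.nest K 0) := by
            rw [hr, ← mul_assoc (S.nest m K), ← S.e_mul_nest_of_le m (by omega), mul_assoc,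
              ← mul_assoc, ← S.e_mul_nest_of_le K (by omega)]
            simp only [mul_assoc]
  · refine ⟨2 * (K + m) + 4 * K - 2 - i, .inr (by omega), low _ (by omega) ?_, ?_⟩
    · unfold BundlePair; omega
    · rw [mul_assoc, ← mul_assoc (S.e i), ← mul_assoc (S.e _),
        ← S.e_mul_nest_reflect K (i' := i) (i := 2 * (K + m) + 4 * K - 2 - i) (by omega)
          (by omega) (by omega)]

variable {A : k} (hA : A ≠ 0) (h2 : S.loop = -(A ^ 2 + A⁻¹ ^ 2))
include hA h2

lemma KillsTurnbacks.mul_bundleCross {n : ℕ} {F : R} (hF : S.KillsTurnbacks n F) (b : Bool) :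
    S.KillsTurnbacks n (F * S.bundleCross A n n (twistPos n b)) := by
  intro i hi
  set p := twistPos n b with hp
  have hb : p = n ∨ p = 2 * n := by cases b <;> simp [hp, twistPos]
  have main : ∃ i', BundlePair n i' ∧
      S.bundleCross A n n p * S.e i = S.e i' * S.bundleCross A n n p := by
    rcases Nat.lt_or_ge (i + 1) p with h₁ | h₁
    · exact ⟨i, hi, (S.bundleCross_local A n n p i (.inl (by omega))).eq⟩
    rcases Nat.lt_or_ge (i + 1) (p + n) with h₂ | h₂
    · exact ⟨i + n, by unfold BundlePair at *; omega,
        S.bundleCross_mul_e_upper hA h2 n n p i (by unfold BundlePair at *; omega) (by omega)⟩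
    rcases Nat.lt_or_ge (i + 1) (p + 2 * n) with h₃ | h₃
    · obtain ⟨r, rfl⟩ : ∃ r, i = r + n := ⟨i - n, by unfold BundlePair at *; omega⟩
      exact ⟨r, by unfold BundlePair at *; omega,
        S.bundleCross_mul_e_lower hA h2 n n p r (by unfold BundlePair at *; omega) (by omega)⟩
    · exact ⟨i, hi, (S.bundleCross_local A n n p i
        (.inr (by unfold BundlePair at *; omega))).eq⟩
  obtain ⟨i', hi', h⟩ := main
  rw [mul_assoc, h, ← mul_assoc, hF i' hi', zero_mul]

/-- The half twist of a planar state modulo turnbacks. -/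
lemma KillsTurnbacks.mul_bundleCross_mul_planarState {n N : ℕ} {F : R}
    (hF : S.KillsTurnbacks n F) (b : Bool) (hN : N ≤ n) :
    F * S.bundleCross A n n (twistPos n b) * S.planarState n b N =
      ∑ j ∈ Finset.range (N + 1), (curlCoeff A N (n - N) * halfTwistCoeff A N j) •
        (F * S.planarState n b j) := by
  have h₁ := hF.slidesOut b hN
  obtain ⟨m, rfl⟩ := Nat.exists_eq_add_of_le hN
  have h₀ := hF.killsInner b
  rw [Nat.add_sub_cancel_left] at h₁ ⊢
  rw [planarState, ← mul_assoc, Nat.add_sub_cancel_left, S.mul_bundleCross_mul_nest hA h2 N m _ h₀,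
    smul_mul_assoc, S.mul_bundleCross_mul hA h2 N _ h₀.mul_nest h₁, Finset.smul_sum, ← curlCoeff]
  refine Finset.sum_congr rfl fun j hj => ?_
  obtain ⟨r, rfl⟩ := Nat.exists_eq_add_of_le (Nat.lt_succ_iff.1 (Finset.mem_range.1 hj))
  rw [smul_smul, Nat.add_sub_cancel_left, S.capNest_mul_planarBase b r (by omega), planarState,
    show j + r + m - j = m + r by omega, nest_add]
  simp only [mul_assoc, add_assoc]

/-- The full twist of a planar state modulo turnbacks. -/
theorem KillsTurnbacks.mul_fullTwist_mul_planarState (hq : ∀ l : ℕ, (A ^ 4) ^ (l + 1) ≠ 1)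
    {n N : ℕ} {F : R} (hF : S.KillsTurnbacks n F) (b : Bool) (hN : N ≤ n) :
    A ^ (2 * (n ^ 2 + 2 * n)) • (F * (S.bundleCross A n n (twistPos n b)) ^ 2 *
      S.planarState n b N) =
      ∑ j ∈ Finset.range (N + 1), fullTwistCoeff A N j • (F * S.planarState n b j) := by
  have h₁ := (hF.mul_bundleCross hA h2 b).mul_bundleCross_mul_planarState hA h2 b hN
  rw [sq (S.bundleCross A n n (twistPos n b)), ← mul_assoc, h₁]
  have h₂ : ∀ i ∈ Finset.range (N + 1),
      (curlCoeff A N (n - N) * halfTwistCoeff A N i) •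
        (F * S.bundleCross A n n (twistPos n b) * S.planarState n b i) =
      ∑ j ∈ Finset.range (N + 1), ((curlCoeff A N (n - N) * halfTwistCoeff A N i) *
        (curlCoeff A i (n - i) * halfTwistCoeff A i j)) • (F * S.planarState n b j) := by
    intro i hi
    have hi' := Finset.mem_range.1 hi
    rw [hF.mul_bundleCross_mul_planarState hA h2 b (by omega), Finset.smul_sum]
    simp only [smul_smul]
    refine Finset.sum_subset (Finset.range_mono (by omega)) fun j _ hj => ?_
    rw [halfTwistCoeff_of_lt A (N := i) (j := j) (by simpa using hj)]; simp
  rw [Finset.sum_congr rfl h₂, Finset.sum_comm, Finset.smul_sum]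
  refine Finset.sum_congr rfl fun j hj => ?_
  rw [← Finset.sum_smul, smul_smul, sum_curlCoeff_mul_halfTwistCoeff hA hq hN
    (Nat.lt_succ_iff.1 (Finset.mem_range.1 hj))]

omit h2 in
lemma KillsTurnbacks.mul_pow (h2 : S.loop = -(A ^ 2 + A⁻¹ ^ 2)) {n : ℕ} {F : R}
    (hF : S.KillsTurnbacks n F) (b : Bool) (m : ℕ) :
    S.KillsTurnbacks n (F * (S.bundleCross A n n (twistPos n b)) ^ m) := by
  induction m with
  | zero => simpa using hF
  | succ m ih =>
    rw [pow_succ, ← mul_assoc]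
    exact ih.mul_bundleCross hA h2 b

end CupCap

/-! ### Sums over chains -/

lemma poch_eq (x : K) (N : ℕ) : poch x N = CupCap.qPoch x N := rfl

lemma sum_chains_zero {V : Type*} [AddCommMonoid V] (N : ℕ) (f : (Fin 0 → ℕ) → V) :
    ∑ c ∈ chains 0 N, f c = f Fin.elim0 := by
  have : chains 0 N = {Fin.elim0} := by
    ext c
    simp [chains, eq_iff_true_of_subsingleton]
  rw [this, Finset.sum_singleton]

lemma sum_chains_succ {V : Type*} [AddCommMonoid V] (m N : ℕ) (f : (Fin (m + 1) → ℕ) → V) :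
    ∑ c ∈ chains (m + 1) N, f c =
      ∑ j ∈ Finset.range (N + 1), ∑ c ∈ chains m j, f (Fin.cons j c) := by
  rw [Finset.sum_sigma']
  refine Finset.sum_nbij' (fun c => ⟨c 0, Fin.tail c⟩) (fun x => Fin.cons x.1 x.2) ?_ ?_ ?_ ?_ ?_
  · intro c hc
    simp only [chains, Finset.mem_filter, Fintype.mem_piFinset, Finset.mem_range, Finset.mem_sigma]
      at hc ⊢
    exact ⟨hc.1 0, fun i => Nat.lt_succ_of_le (hc.2 _ _ (Fin.zero_le _)),
      fun i j hij => hc.2 _ _ (Fin.succ_le_succ_iff.2 hij)⟩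
  · rintro ⟨j, c⟩ hc
    simp only [chains, Finset.mem_filter, Fintype.mem_piFinset, Finset.mem_range, Finset.mem_sigma]
      at hc ⊢
    refine ⟨fun i => ?_, fun i l hil => ?_⟩
    · refine Fin.cases ?_ (fun i => ?_) i
      · simpa using hc.1
      · have := hc.2.1 i
        simp only [Fin.cons_succ]; omega
    · induction i using Fin.cases with
      | zero =>
        induction l using Fin.cases with
        | zero => simp
        | succ l => simpa using Nat.lt_succ_iff.1 (hc.2.1 l)
      | succ i =>
        induction l using Fin.cases with
        | zero => exact absurd hil (by simp)
        | succ l => simpa using hc.2.2 _ _ (Fin.succ_le_succ_iff.1 hil)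
  · intro c _; simp
  · rintro ⟨j, c⟩ _; simp
  · intro c _; simp

lemma lastTerm_zero (N : ℕ) (c : Fin 0 → ℕ) : lastTerm N c = N := rfl

lemma lastTerm_cons {m : ℕ} (N j : ℕ) (c : Fin m → ℕ) :
    lastTerm N (Fin.cons j c : Fin (m + 1) → ℕ) = lastTerm j c := by
  simp only [lastTerm, extend, ← Fin.succ_last, Fin.cons_succ]

lemma lastTerm_le {m N : ℕ} {c : Fin m → ℕ} (hc : c ∈ chains m N) : lastTerm N c ≤ N := by
  cases m with
  | zero => exact le_rfl
  | succ m =>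
    simp only [chains, Finset.mem_filter, Fintype.mem_piFinset, Finset.mem_range] at hc
    simp only [lastTerm, extend, ← Fin.succ_last, Fin.cons_succ]
    exact Nat.lt_succ_iff.1 (hc.1 _)

lemma prod_poch_differences (x : K) {m : ℕ} (N : ℕ) (c : Fin m → ℕ) :
    ∏ i, poch x (differences N c i) =
      (∏ i : Fin m, poch x (extend N c i.castSucc - extend N c i.succ)) *
        poch x (lastTerm N c) := by
  rw [Fin.prod_univ_castSucc]
  simp only [differences, Fin.snoc_castSucc, Fin.snoc_last]

lemma prod_poch_differences_cons (x : K) {m : ℕ} (N j : ℕ) (c : Fin m → ℕ) :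
    ∏ i, poch x (differences N (Fin.cons j c : Fin (m + 1) → ℕ) i) =
      poch x (N - j) * ∏ i, poch x (differences j c i) := by
  rw [prod_poch_differences, prod_poch_differences, Fin.prod_univ_succ, lastTerm_cons, mul_assoc]
  simp only [extend, Fin.castSucc_zero, Fin.cons_zero, Fin.cons_succ, ← Fin.succ_castSucc]

/-! ### Summands of a twist region -/

lemma q4_ne_zero : q4 ≠ 0 := RatFunc.X_ne_zero

lemma q4_pow_ne_one {m : ℕ} (hm : m ≠ 0) : q4 ^ m ≠ 1 := by
  intro h
  have h' : algebraMap (Polynomial ℚ) K (Polynomial.X ^ m) = algebraMap (Polynomial ℚ) K 1 := by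
    rw [map_pow, RatFunc.algebraMap_X, map_one]
    exact h
  have := congrArg Polynomial.natDegree (RatFunc.algebraMap_injective ℚ h')
  simp [hm] at this

lemma q4_zpow_ne_one {m : ℤ} (hm : m ≠ 0) : q4 ^ m ≠ 1 := by
  obtain ⟨l, rfl | rfl⟩ := m.eq_nat_or_neg
  · rw [zpow_natCast]
    exact q4_pow_ne_one (by rintro rfl; simp at hm)
  · rw [zpow_neg, zpow_natCast, ne_eq, inv_eq_one]
    exact q4_pow_ne_one (by rintro rfl; simp at hm)

lemma twistTerm_eq (ε : ℤ) {m : ℕ} (N : ℕ) (c : Fin m → ℕ) (h : lastTerm N c ≤ N) :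
    twistTerm ε N c = (-1) ^ (N - lastTerm N c) * (q4 ^ ε) ^ (2 * (N - lastTerm N c)) *
      (q4 ^ ε) ^ (4 * ∑ i, (c i ^ 2 + c i)) *
      (poch ((q4 ^ ε) ^ 4) N / poch ((q4 ^ ε) ^ 4) (lastTerm N c)) *
      qMultinomial ((q4 ^ ε) ^ 4) N (differences N c) := by
  have h₁ : q4 ^ (4 * ε) = (q4 ^ ε) ^ 4 := by rw [mul_comm, zpow_mul]; rfl
  have h₂ : q4 ^ (2 * ε * ((N : ℤ) - lastTerm N c)) = (q4 ^ ε) ^ (2 * (N - lastTerm N c)) := by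
    rw [← zpow_natCast, ← zpow_mul]
    push_cast [h]
    congr 1
    ring
  have h₃ : q4 ^ (4 * ε * ∑ i, ((c i : ℤ) ^ 2 + c i)) =
      (q4 ^ ε) ^ (4 * ∑ i, (c i ^ 2 + c i)) := by
    rw [← zpow_natCast, ← zpow_mul]
    push_cast
    congr 1
    ring
  rw [twistTerm, h₁, h₂, h₃]

lemma twistTerm_zero {ε : ℤ} (hq : ∀ l : ℕ, ((q4 ^ ε) ^ 4) ^ (l + 1) ≠ 1) (N : ℕ)
    (c : Fin 0 → ℕ) : twistTerm ε N c = 1 := by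
  have h := CupCap.qPoch_ne_zero hq N
  rw [twistTerm_eq _ _ _ le_rfl, qMultinomial, prod_poch_differences, lastTerm_zero]
  rw [← poch_eq] at h
  simp [h]

/-- The summand of a twist region with `m + 1` full twists splits off the coefficient of the first
full twist. -/
lemma twistTerm_cons {ε : ℤ} (hq : ∀ l : ℕ, ((q4 ^ ε) ^ 4) ^ (l + 1) ≠ 1) {m N j : ℕ}
    (c : Fin m → ℕ) (hj : j ≤ N) (hc : lastTerm j c ≤ j) :
    twistTerm ε N (Fin.cons j c : Fin (m + 1) → ℕ) =
      CupCap.fullTwistCoeff (q4 ^ ε) N j * twistTerm ε j c := by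
  rw [twistTerm_eq _ _ _ (by rw [lastTerm_cons]; omega), twistTerm_eq _ _ _ hc, qMultinomial,
    qMultinomial, prod_poch_differences_cons, lastTerm_cons, CupCap.fullTwistCoeff,
    Fin.sum_univ_succ]
  have hne : ∀ n, poch ((q4 ^ ε) ^ 4) n ≠ 0 := fun n => CupCap.qPoch_ne_zero hq n
  have hne' := hne j
  have hprod : ∏ i, poch ((q4 ^ ε) ^ 4) (differences j c i) ≠ 0 :=
    Finset.prod_ne_zero_iff.2 fun i _ => hne _
  simp only [← poch_eq, Fin.cons_zero, Fin.cons_succ]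
  obtain ⟨r, hr⟩ := Nat.exists_eq_add_of_le hc
  obtain ⟨s, rfl⟩ := Nat.exists_eq_add_of_le hj
  rw [Nat.add_sub_cancel_left, show j + s - lastTerm j c = s + (j - lastTerm j c) by omega]
  generalize q4 ^ ε = A at *
  have h₁ := hne s
  have h₂ := hne (lastTerm j c)
  generalize poch (A ^ 4) (j + s) = a₁ at *
  generalize poch (A ^ 4) j = a₂ at *
  generalize poch (A ^ 4) s = a₃ at *
  generalize poch (A ^ 4) (lastTerm j c) = a₄ at *
  generalize ∏ i, poch (A ^ 4) (differences j c i) = a₅ at *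
  field_simp
  ring

namespace CupCap

variable {R : Type*} [Ring R] [Algebra K R] {S : CupCap K R}

/-- A twist region with `m` full twists. -/
lemma KillsTurnbacks.mul_fullTwists_mul_planarState {ε : ℤ}
    (h2 : S.loop = -((q4 ^ ε) ^ 2 + (q4 ^ ε)⁻¹ ^ 2))
    (hq : ∀ l : ℕ, ((q4 ^ ε) ^ 4) ^ (l + 1) ≠ 1) {n : ℕ} {F : R} (hF : S.KillsTurnbacks n F)
    (b : Bool) (m : ℕ) {N : ℕ} (hN : N ≤ n) :
    ((q4 ^ ε) ^ (2 * (n ^ 2 + 2 * n))) ^ m •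
      (F * (S.bundleCross (q4 ^ ε) n n (twistPos n b)) ^ (2 * m) * S.planarState n b N) =
      ∑ c ∈ chains m N, twistTerm ε N c • (F * S.planarState n b (lastTerm N c)) := by
  have hA : q4 ^ ε ≠ 0 := zpow_ne_zero _ q4_ne_zero
  induction m generalizing N with
  | zero =>
    rw [sum_chains_zero, twistTerm_zero hq, lastTerm_zero]
    simp
  | succ m ih =>
    have h₁ := (hF.mul_pow hA h2 b (2 * m)).mul_fullTwist_mul_planarState hA h2 hq b hN
    rw [pow_succ, mul_smul, mul_add 2 m 1, mul_one, pow_add _ (2 * m), ← mul_assoc, h₁,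
      Finset.smul_sum, sum_chains_succ]
    refine Finset.sum_congr rfl fun j hj => ?_
    have hj' := Nat.lt_succ_iff.1 (Finset.mem_range.1 hj)
    rw [smul_comm, ih (hj'.trans hN), Finset.smul_sum]
    refine Finset.sum_congr rfl fun c hc => ?_
    rw [smul_smul, twistTerm_cons hq c hj' (lastTerm_le hc), lastTerm_cons]

end CupCap

/-! ### Quantum integers -/

lemma q4_sub_ne_zero {m : ℤ} (hm : m ≠ 0) : q4 ^ (2 * m) - q4 ^ (-(2 * m)) ≠ 0 := by
  intro h
  have h₁ : q4 ^ (2 * m) * q4 ^ (2 * m) = 1 := by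
    nth_rw 2 [sub_eq_zero.1 h]
    rw [← zpow_add₀ q4_ne_zero, add_neg_cancel, zpow_zero]
  rw [← zpow_add₀ q4_ne_zero] at h₁
  exact q4_zpow_ne_one (by omega) h₁

lemma qInt_denom_ne_zero : q4 ^ (2 : ℤ) - q4 ^ (-2 : ℤ) ≠ 0 := by
  simpa using q4_sub_ne_zero one_ne_zero

lemma qInt_ne_zero {m : ℤ} (hm : m ≠ 0) : qInt m ≠ 0 :=
  div_ne_zero (q4_sub_ne_zero hm) qInt_denom_ne_zero

lemma qInt_one : qInt 1 = 1 := by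
  rw [qInt, mul_one, div_self qInt_denom_ne_zero]

lemma qInt_two : qInt 2 = q4 ^ 2 + q4⁻¹ ^ 2 := by
  rw [qInt, div_eq_iff qInt_denom_ne_zero, show (2 : ℤ) * 2 = 2 + 2 by norm_num, neg_add,
    zpow_add₀ q4_ne_zero, zpow_add₀ q4_ne_zero, zpow_neg, zpow_ofNat, inv_pow]
  ring

lemma qInt_two_mul (m : ℤ) : qInt 2 * qInt (m + 1) = qInt (m + 2) + qInt m := by
  have h0 := q4_ne_zero
  rw [qInt_two]
  simp only [qInt]
  rw [← add_div, mul_div_assoc']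
  congr 1
  simp only [mul_add, neg_add, zpow_add₀ h0, zpow_neg, inv_pow,
    show (2 : ℤ) * 2 = (4 : ℕ) by norm_num, show (2 : ℤ) * 1 = (2 : ℕ) by norm_num, zpow_natCast]
  have := zpow_ne_zero (2 * m) h0
  field_simp
  ring

lemma qInt_two_mul_sub_div (n : ℕ) :
    -qInt 2 + qInt (n + 1) / qInt (n + 2) = -(qInt (n + 3) / qInt (n + 2)) := by
  have h := qInt_ne_zero (m := n + 2) (by omega)
  have h' := qInt_two_mul (n + 1)
  rw [show (n : ℤ) + 1 + 1 = n + 2 by ring, show (n : ℤ) + 1 + 2 = n + 3 by ring] at h'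
  field_simp
  linear_combination -h'

namespace CupCap

variable {R : Type*} [Ring R] [Algebra K R] (S : CupCap K R)

/-! ### Jones–Wenzl idempotents -/

/-- The Jones–Wenzl idempotent on the `n` strands at the positions `i, …, i + n - 1`. -/
def clasp : ℕ → ℕ → R
  | 0, _ => 1
  | 1, _ => 1
  | n + 2, i => clasp (n + 1) i +
      (qInt (n + 1) / qInt (n + 2)) • (clasp (n + 1) i * S.e (i + n) * clasp (n + 1) i)

lemma clasp_local (n i : ℕ) : S.Local i (i + n) (S.clasp n i) := by
  induction n using Nat.strong_induction_on with
  | _ n ih =>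
    match n with
    | 0 => exact Local.one
    | 1 => exact Local.one
    | n + 2 =>
      have h := (ih (n + 1) (by omega)).mono (a' := i) (b' := i + (n + 2)) le_rfl (by omega)
      exact h.add (((h.mul (Local.e (by omega) (by omega))).mul h).smul _)

lemma clasp_mul_U {n i j : ℕ} (h : i + n ≤ j) : S.clasp n i * S.U j = S.U j * S.clasp n i := by
  induction n using Nat.strong_induction_on with
  | _ n ih =>
    match n with
    | 0 => simp [clasp]
    | 1 => simp [clasp]
    | n + 2 =>
      have h₁ := ih (n + 1) (by omega) (by omega)
      have h₂ := S.e_mul_U_of_le (i := i + n) (j := j) (by omega)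
      simp only [clasp, add_mul, mul_add, smul_mul_assoc, mul_smul_comm, mul_assoc, h₁]
      rw [← mul_assoc (S.e _), h₂, mul_assoc, ← mul_assoc (S.clasp _ _) (S.U j), h₁, mul_assoc]

lemma D_mul_clasp {n i j : ℕ} (h : i + n ≤ j) : S.D j * S.clasp n i = S.clasp n i * S.D j := by
  induction n using Nat.strong_induction_on with
  | _ n ih =>
    match n with
    | 0 => simp [clasp]
    | 1 => simp [clasp]
    | n + 2 =>
      have h₁ := ih (n + 1) (by omega) (by omega)
      have h₂ := S.D_mul_e_of_le (i := i + n) (j := j) (by omega)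
      simp only [clasp, add_mul, mul_add, smul_mul_assoc, mul_smul_comm, ← mul_assoc, h₁]
      rw [mul_assoc _ (S.D j), h₂, ← mul_assoc, mul_assoc _ (S.D j), h₁, ← mul_assoc]

section Wenzl

variable {S} (hS : S.loop = -qInt 2)
include hS

/-- The partial trace of a clasp, provided that the next smaller clasp is idempotent. -/
lemma D_mul_clasp_mul_U_of_idem {n i : ℕ} (h : S.clasp n i * S.clasp n i = S.clasp n i) :
    S.D (i + n) * S.clasp (n + 1) i * S.U (i + n) =
      (-(qInt (n + 2) / qInt (n + 1))) • S.clasp n i := by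
  match n with
  | 0 => simp [clasp, S.D_U_self, hS, qInt_one]
  | n + 1 =>
    have h₁ : S.D (i + (n + 1)) * S.clasp (n + 1) i * S.U (i + (n + 1)) =
        S.loop • S.clasp (n + 1) i := by
      rw [mul_assoc, S.clasp_mul_U (by omega), ← mul_assoc, S.D_U_self, smul_mul_assoc, one_mul]
    have h₂ : S.D (i + (n + 1)) * (S.clasp (n + 1) i * S.e (i + n) * S.clasp (n + 1) i) *
        S.U (i + (n + 1)) = S.clasp (n + 1) i := by
      calc _ = S.D (i + (n + 1)) * S.clasp (n + 1) i * S.e (i + n) *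
            (S.clasp (n + 1) i * S.U (i + (n + 1))) := by simp only [mul_assoc]
        _ = S.clasp (n + 1) i * (S.D (i + n + 1) * S.e (i + n) * S.U (i + n + 1)) *
            S.clasp (n + 1) i := by
          rw [S.D_mul_clasp (by omega), S.clasp_mul_U (by omega)]
          simp only [mul_assoc, add_assoc]
        _ = _ := by rw [S.D_succ_mul_e, S.D_U_succ, mul_one, h]
    rw [clasp, mul_add, add_mul, mul_smul_comm, smul_mul_assoc, h₁, h₂, ← add_smul, hS]
    push_cast
    rw [qInt_two_mul_sub_div, show (n : ℤ) + 1 + 2 = n + 3 by ring,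
      show (n : ℤ) + 1 + 1 = n + 2 by ring]

/-- The partial trace of the smaller clasp shows that the new hook is killed; with the killing of
all hooks comes idempotence. -/
lemma clasp_idem_and_kills (n i : ℕ) : S.clasp n i * S.clasp n i = S.clasp n i ∧
    ∀ j, i ≤ j → j + 2 ≤ i + n → S.e j * S.clasp n i = 0 ∧ S.clasp n i * S.e j = 0 := by
  induction n using Nat.strong_induction_on with
  | _ n ih =>
    match n with
    | 0 => exact ⟨by simp [clasp], fun j h₁ h₂ => by omega⟩
    | 1 => exact ⟨by simp [clasp], fun j h₁ h₂ => by omega⟩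
    | n + 2 =>
      obtain ⟨hP, hk⟩ := ih (n + 1) (by omega)
      have hn := (ih n (by omega)).1
      have hne := qInt_ne_zero (m := n + 1) (by omega)
      have hne' := qInt_ne_zero (m := n + 2) (by omega)
      set P := S.clasp (n + 1) i with hPdef
      set E := S.e (i + n) with hE
      set μ := qInt (n + 1) / qInt (n + 2) with hμ
      have hμ' : μ * -(qInt (n + 2) / qInt (n + 1)) = -1 := by
        rw [hμ]; field_simp
      have hQ : S.clasp n i * P = P ∧ P * S.clasp n i = P := by
        match n with
        | 0 => simp [clasp]
        | n + 1 =>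
          rw [hPdef, clasp]
          constructor
          · rw [mul_add, mul_smul_comm, ← mul_assoc, ← mul_assoc, hn]
          · rw [add_mul, smul_mul_assoc, mul_assoc, hn]
      have hEPE : E * P * E = (-(qInt (n + 2) / qInt (n + 1))) • (E * S.clasp n i) := by
        calc E * P * E = S.U (i + n) * (S.D (i + n) * P * S.U (i + n)) * S.D (i + n) := by
              simp only [hE, e, mul_assoc]
          _ = _ := by
              rw [hPdef, D_mul_clasp_mul_U_of_idem hS hn, mul_smul_comm, smul_mul_assoc, mul_assoc,
                ← S.D_mul_clasp le_rfl, ← mul_assoc, hE, e]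
      have hEPE' : E * P * E = (-(qInt (n + 2) / qInt (n + 1))) • (S.clasp n i * E) := by
        rw [hEPE, (S.clasp_local n i (i + n) (.inr le_rfl)).eq]
      have hc : S.clasp (n + 2) i = P + μ • (P * E * P) := rfl
      have hEc : E * S.clasp (n + 2) i = 0 := by
        calc E * S.clasp (n + 2) i = E * P + μ • ((E * P * E) * P) := by
              rw [hc, mul_add, mul_smul_comm]; simp only [mul_assoc]
          _ = 0 := by
              rw [hEPE, smul_mul_assoc, smul_smul, hμ', mul_assoc, hQ.1, neg_one_smul,
                add_neg_cancel]
      have hcE : S.clasp (n + 2) i * E = 0 := by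
        calc S.clasp (n + 2) i * E = P * E + μ • (P * (E * P * E)) := by
              rw [hc, add_mul, smul_mul_assoc]; simp only [mul_assoc]
          _ = 0 := by
              rw [hEPE', mul_smul_comm, smul_smul, hμ', ← mul_assoc, hQ.2, neg_one_smul,
                add_neg_cancel]
      have hcP : S.clasp (n + 2) i * P = S.clasp (n + 2) i := by
        rw [hc, add_mul, smul_mul_assoc, mul_assoc _ P P, hP]
      refine ⟨?_, fun j h₁ h₂ => ?_⟩
      · calc S.clasp (n + 2) i * S.clasp (n + 2) i = S.clasp (n + 2) i * P +
              μ • (S.clasp (n + 2) i * P * E * P) := by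
              nth_rw 2 [hc]
              rw [mul_add, mul_smul_comm]
              simp only [mul_assoc]
          _ = _ := by rw [hcP, hcE, zero_mul, smul_zero, add_zero]
      · rcases Nat.lt_or_ge j (i + n) with hj | hj
        · obtain ⟨k₁, k₂⟩ := hk j h₁ (by omega)
          constructor
          · rw [hc, mul_add, mul_smul_comm, ← mul_assoc, ← mul_assoc, k₁]; simp
          · rw [hc, add_mul, smul_mul_assoc, mul_assoc, k₂]; simp
        · obtain rfl : j = i + n := by omega
          exact ⟨hEc, hcE⟩

lemma e_mul_clasp {n i j : ℕ} (h₁ : i ≤ j) (h₂ : j + 2 ≤ i + n) : S.e j * S.clasp n i = 0 :=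
  ((clasp_idem_and_kills hS n i).2 j h₁ h₂).1

lemma clasp_mul_e {n i j : ℕ} (h₁ : i ≤ j) (h₂ : j + 2 ≤ i + n) : S.clasp n i * S.e j = 0 :=
  ((clasp_idem_and_kills hS n i).2 j h₁ h₂).2

lemma D_mul_clasp_mul_U (n i : ℕ) : S.D (i + n) * S.clasp (n + 1) i * S.U (i + n) =
    (-(qInt (n + 2) / qInt (n + 1))) • S.clasp n i :=
  D_mul_clasp_mul_U_of_idem hS (clasp_idem_and_kills hS n i).1

/-- Closing up the last `j` of `N + j` strands with a clasp. -/
lemma capNest_mul_clasp_mul_nest (N j i : ℕ) :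
    S.capNest j (i + N) * S.clasp (N + j) i * S.nest j (i + N) =
      ((-1) ^ j * (qInt (N + j + 1) / qInt (N + 1))) • S.clasp N i := by
  induction j with
  | zero => simp [capNest, nest, div_self (qInt_ne_zero (m := N + 1) (by omega))]
  | succ j ih =>
    have hne := qInt_ne_zero (m := N + j + 1) (by omega)
    calc _ = S.capNest j (i + N) *
          (S.D (i + (N + j)) * S.clasp (N + j + 1) i * S.U (i + (N + j))) * S.nest j (i + N) := by
          simp only [capNest, nest, mul_assoc, add_assoc]
      _ = _ := by
          rw [D_mul_clasp_mul_U hS, mul_smul_comm, smul_mul_assoc, ih, smul_smul]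
          congr 1
          push_cast
          rw [show (N : ℤ) + (j + 1) + 1 = N + j + 2 by ring]
          field_simp
          ring

end Wenzl

variable {S} in
/-- A clasp may be dropped if all of its strands lead to places that kill turnbacks. -/
lemma mul_clasp_mul {n i : ℕ} {F t : R}
    (h : ∀ T, S.Local i (i + n) T → ∀ j, i ≤ j → j + 2 ≤ i + n → F * T * (S.e j * t) = 0) :
    F * S.clasp n i * t = F * t := by
  induction n using Nat.strong_induction_on generalizing F with
  | _ n ih =>
    match n with
    | 0 => simp [clasp]
    | 1 => simp [clasp]
    | n + 2 =>
      have hl := (S.clasp_local (n + 1) i).mono (a' := i) (b' := i + (n + 2)) le_rfl (by omega)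
      have hel : S.Local i (i + (n + 2)) (S.e (i + n)) := Local.e (by omega) (by omega)
      have h₁ := ih (n + 1) (by omega) (F := F) fun T hT j h₁ h₂ =>
        h T (hT.mono le_rfl (by omega)) j h₁ (by omega)
      have h₂ := ih (n + 1) (by omega) (F := F * S.clasp (n + 1) i * S.e (i + n))
        fun T hT j h₁ h₂ => by
          have := h (S.clasp (n + 1) i * S.e (i + n) * T)
            ((hl.mul hel).mul (hT.mono le_rfl (by omega))) j h₁ (by omega)
          simpa only [mul_assoc] using this
      have h₃ := h (S.clasp (n + 1) i) hl (i + n) (by omega) (by omega)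
      simp only [mul_assoc] at h₁ h₂ h₃ ⊢
      simp only [clasp, add_mul, mul_add, smul_mul_assoc, mul_smul_comm, mul_assoc, h₁, h₂, h₃,
        smul_zero, add_zero]

/-! ### Closing up -/

/-- The circle colored by `n`. -/
def circle (n : ℕ) : R := S.capNest n 0 * S.clasp n 0 * S.nest n 0

/-- Four bundles of `n` strands are closed up, with clasps in the first bundle and in the upper
one of the two bundles at position `twistPos n b`, which are joined to each other. -/
def closing (n : ℕ) (b : Bool) : R :=
  S.capNest n 0 * S.clasp n 0 * (S.capNest n (twistPos n b) * S.clasp n (twistPos n b))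

lemma closingTerm_eq (n N : ℕ) :
    closingTerm n N = (-1) ^ (n - N) * (qInt (n + 1) / qInt (N + 1)) := by
  have h0 := q4_ne_zero
  have key : ∀ m : ℕ, q4 ^ (2 * ((m : ℤ) + 1)) - q4 ^ (-(2 * ((m : ℤ) + 1))) =
      -(q4 ^ (-(2 * ((m : ℤ) + 1))) * (1 - q4 ^ (4 * (m + 1)))) := by
    intro m
    rw [← zpow_natCast q4 (4 * (m + 1)), mul_sub, ← zpow_add₀ h0]
    push_cast
    rw [show -(2 * ((m : ℤ) + 1)) + 4 * (m + 1) = 2 * (m + 1) by ring]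
    ring
  have hz : q4 ^ (2 * ((N : ℤ) - n)) =
      q4 ^ (-(2 * ((n : ℤ) + 1))) / q4 ^ (-(2 * ((N : ℤ) + 1))) := by
    rw [← zpow_sub₀ h0]; congr 1; ring
  rw [closingTerm, qInt, qInt, div_div_div_cancel_right₀ qInt_denom_ne_zero, key, key,
    neg_div_neg_eq, hz, mul_assoc, div_mul_div_comm]

variable {S} (hS : S.loop = -qInt 2)
include hS

lemma capNest_mul_clasp_mul_e {n p i : ℕ} (hi : InnerPair p n i) :
    S.capNest n p * S.clasp n p * S.e i = 0 := by
  rcases hi with ⟨h₁, h₂⟩ | ⟨h₁, h₂⟩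
  · rw [mul_assoc, clasp_mul_e hS h₁ h₂, mul_zero]
  · rw [mul_assoc, (S.clasp_local n p i (.inr h₁)).eq, ← mul_assoc,
      S.capNest_mul_e_reflect n h₁ h₂ (i' := 2 * (p + n) - 2 - i) (by omega), mul_assoc,
      e_mul_clasp hS (by omega) (by omega), mul_zero]

lemma closing_killsTurnbacks (n : ℕ) (b : Bool) : S.KillsTurnbacks n (S.closing n b) := by
  intro i hi
  have hb : twistPos n b = n ∨ twistPos n b = 2 * n := by cases b <;> simp [twistPos]
  set p := twistPos n b with hp
  by_cases hi' : InnerPair p n i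
  · rw [closing, mul_assoc, capNest_mul_clasp_mul_e hS hi', mul_zero]
  · obtain ⟨l, hl, h⟩ : ∃ l, InnerPair 0 n l ∧ S.capNest n p * S.e i = S.e l * S.capNest n p := by
      rcases Nat.lt_or_ge (i + 1) p with h₁ | h₁
      · exact ⟨i, by unfold InnerPair BundlePair at *; omega,
          S.capNest_mul_e_of_le n (by omega)⟩
      · obtain ⟨l, rfl⟩ : ∃ l, i = l + 2 * n := ⟨i - 2 * n, by
          unfold InnerPair BundlePair at *; omega⟩
        exact ⟨l, by unfold InnerPair BundlePair at *; omega,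
          S.capNest_mul_e_of_ge n (by unfold InnerPair BundlePair at *; omega)⟩
    rw [closing, ← hp, mul_assoc, mul_assoc _ (S.clasp n p), (S.clasp_local n p i (by
      unfold InnerPair BundlePair at *; omega)).eq, ← mul_assoc (S.capNest n p), h]
    rw [mul_assoc (S.e l), ← mul_assoc, capNest_mul_clasp_mul_e hS hl, zero_mul]

/-- Closing up a planar state: the `n - N` arcs between the bundles to be closed up give a partial
trace of their clasp. -/
lemma closing_mul_planarState {n N : ℕ} (b : Bool) (h : N ≤ n) :
    S.closing n b * S.planarState n b N = closingTerm n N • S.circle n := by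
  have hb : twistPos n b = n ∨ twistPos n b = 2 * n := by cases b <;> simp [twistPos]
  have hslide := fun i i' => S.e_mul_planarBase (i := i) (i' := i') b h
  have hcap := S.capNest_mul_planarBase (n := n) (K := 0) b N (by omega)
  have hbase : S.planarBase n b 0 = S.nest n 0 := by cases b <;> simp [planarBase, nest]
  rw [closingTerm_eq, closing, planarState]
  set p := twistPos n b
  rw [hbase, add_zero, zero_add] at hcap
  obtain ⟨j, rfl⟩ := Nat.exists_eq_add_of_le h
  rw [Nat.add_sub_cancel_left]
  set n := N + j with hn
  have hdrop : S.capNest n 0 * S.clasp n 0 * S.capNest N p * S.clasp N p * S.planarBase n b N =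
      S.capNest n 0 * S.clasp n 0 * S.capNest N p * S.planarBase n b N := by
    refine mul_clasp_mul fun T hT i h₁ h₂ => ?_
    have hF : S.capNest n 0 * S.clasp n 0 * S.capNest N p * S.e (2 * p - 2 - i) = 0 := by
      rw [mul_assoc, S.capNest_mul_e_of_le N (by omega), ← mul_assoc,
        capNest_mul_clasp_mul_e hS (by unfold InnerPair; omega), zero_mul]
    rw [hslide i (2 * p - 2 - i) h₁ h₂ (by omega), ← mul_assoc, mul_assoc _ T,
      (hT _ (.inl (by omega))).eq, ← mul_assoc, hF, zero_mul, zero_mul]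
  have htrace := capNest_mul_clasp_mul_nest hS N j p
  calc _ = S.capNest n 0 * S.clasp n 0 * S.capNest N p *
        (S.capNest j (p + N) * S.clasp n p * S.nest j (p + N)) * S.planarBase n b N := by
        have : S.capNest n p = S.capNest N p * S.capNest j (p + N) := by
          rw [hn, add_comm N j, capNest_add]
        rw [this]
        simp only [mul_assoc]
    _ = ((-1) ^ j * (qInt (N + j + 1) / qInt (N + 1))) •
        (S.capNest n 0 * S.clasp n 0 * S.capNest N p * S.clasp N p * S.planarBase n b N) := by
        rw [htrace]; simp only [mul_smul_comm, smul_mul_assoc]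
    _ = _ := by
        rw [hdrop, mul_assoc _ (S.capNest N p), hcap, circle, hn]
        push_cast
        rfl

/-- The circle is the quantum dimension. -/
lemma circle_eq (n : ℕ) : S.circle n = ((-1) ^ n * qInt (n + 1)) • (1 : R) := by
  have h := capNest_mul_clasp_mul_nest hS 0 n 0
  simp only [add_zero, zero_add, Nat.cast_zero] at h
  rw [circle, h, clasp, qInt_one, div_one]

/-! ### The twist regions of a 2-bridge link -/

omit hS
variable (S)

/-- The twist regions of a list, alternately at the two possible positions. -/
def twists (n : ℕ) : Bool → List ℤ → R
  | _, [] => 1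
  | b, a :: as => twists n (!b) as *
      (S.bundleCross (q4 ^ a.sign) n n (twistPos n b)) ^ (2 * a.natAbs)

/-- The position that is next after the twist regions of a list. -/
def endFlag : Bool → List ℤ → Bool
  | b, [] => b
  | b, _ :: as => endFlag (!b) as

lemma q4_zpow_sign_pow_ne_one {a : ℤ} (ha : a ≠ 0) (l : ℕ) :
    ((q4 ^ a.sign) ^ 4) ^ (l + 1) ≠ 1 := by
  rw [← pow_mul, ← zpow_natCast, ← zpow_mul]
  have := mt Int.sign_eq_zero_iff_zero.1 ha
  exact q4_zpow_ne_one (mul_ne_zero this (by positivity))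

variable {S}
include hS

lemma loop_eq_of_sign {a : ℤ} (ha : a ≠ 0) :
    S.loop = -((q4 ^ a.sign) ^ 2 + (q4 ^ a.sign)⁻¹ ^ 2) := by
  rw [hS, qInt_two]
  rcases lt_or_gt_of_ne ha with h | h
  · rw [Int.sign_eq_neg_one_of_neg h, zpow_neg_one, inv_inv, add_comm]
  · rw [Int.sign_eq_one_of_pos h, zpow_one]

/-- The closed 2-bridge diagram, up to its framing factor, applied to a planar state. -/
theorem closing_mul_twists_mul_planarState (n : ℕ) (as : List ℤ) (ha : ∀ x ∈ as, x ≠ 0) (b : Bool) :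
    S.KillsTurnbacks n (S.closing n (endFlag b as) * S.twists n b as) ∧ ∀ N ≤ n,
      q4 ^ (2 * ((n : ℤ) ^ 2 + 2 * n) * as.sum) •
        (S.closing n (endFlag b as) * S.twists n b as * S.planarState n b N) =
      twistSum n as N • S.circle n := by
  induction as generalizing b with
  | nil =>
    simp only [endFlag, twists, mul_one, List.sum_nil, mul_zero, zpow_zero, one_smul, twistSum]
    exact ⟨closing_killsTurnbacks hS n b, fun N hN => closing_mul_planarState hS b hN⟩
  | cons a as ih =>
    obtain ⟨ihF, ihN⟩ := ih (fun x hx => ha x (List.mem_cons_of_mem _ hx)) (!b)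
    have ha' : a ≠ 0 := ha a List.mem_cons_self
    have h2 := loop_eq_of_sign hS ha'
    have hq := q4_zpow_sign_pow_ne_one ha'
    have hA : q4 ^ a.sign ≠ 0 := zpow_ne_zero _ q4_ne_zero
    simp only [endFlag, twists, ← mul_assoc]
    refine ⟨ihF.mul_pow hA h2 b _, fun N hN => ?_⟩
    have h₁ := ihF.mul_fullTwists_mul_planarState h2 hq b a.natAbs hN
    have hsplit : q4 ^ (2 * ((n : ℤ) ^ 2 + 2 * n) * (a :: as).sum) =
        q4 ^ (2 * ((n : ℤ) ^ 2 + 2 * n) * as.sum) *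
          ((q4 ^ a.sign) ^ (2 * (n ^ 2 + 2 * n))) ^ a.natAbs := by
      rw [← pow_mul, ← zpow_natCast, ← zpow_mul, ← zpow_add₀ q4_ne_zero]
      congr 1
      have := Int.sign_mul_natAbs a
      push_cast at this ⊢
      rw [List.sum_cons]
      linear_combination (-(2 * ((n : ℤ) ^ 2 + 2 * n))) * this
    rw [hsplit, mul_smul, h₁, Finset.smul_sum, twistSum, Finset.sum_smul]
    refine Finset.sum_congr rfl fun c hc => ?_
    rw [smul_comm, ← S.planarState_not b ((lastTerm_le hc).trans hN), ihN _ (by omega), smul_smul]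

lemma commute_twists_e (n : ℕ) (as : List ℤ) (ha : ∀ x ∈ as, x ≠ 0) (b : Bool) {i : ℕ}
    (hi : InnerPair 0 n i) : Commute (S.twists n b as) (S.e i) := by
  induction as generalizing b with
  | nil => exact Commute.one_left _
  | cons a as ih =>
    have ha' : a ≠ 0 := ha a List.mem_cons_self
    have h2 := loop_eq_of_sign hS ha'
    have hA : q4 ^ a.sign ≠ 0 := zpow_ne_zero _ q4_ne_zero
    refine (ih (fun x hx => ha x (List.mem_cons_of_mem _ hx)) (!b)).mul_left ?_
    rw [pow_mul]
    refine Commute.pow_left ?_ _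
    unfold InnerPair at hi
    by_cases hi' : i + 2 ≤ twistPos n b
    · exact (S.bundleCross_local _ n n _ i (.inl hi')).pow_left 2
    · have hp : twistPos n b = n := by cases b <;> simp_all [twistPos]; omega
      rw [hp] at hi' ⊢
      have h₁ := S.bundleCross_mul_e_upper hA h2 n n n i (by omega) (by omega)
      have h₂ := S.bundleCross_mul_e_lower hA h2 n n n i (by omega) (by omega)
      rw [Commute, SemiconjBy, sq, mul_assoc, h₁, ← mul_assoc, h₂, mul_assoc]

/-- If the middle bundles are closed up first, the clasp on the second bundle may be dropped: it
slides through the twist regions and along the arcs to the first bundle. -/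
lemma closing_mul_twists_mul_nest (n : ℕ) (as : List ℤ) (ha : ∀ x ∈ as, x ≠ 0) (b : Bool) :
    S.capNest n 0 * S.clasp n 0 * S.capNest n n * S.twists n b as * S.planarState n true n =
      S.closing n true * S.twists n b as * S.planarState n true n := by
  have h : S.capNest n 0 * S.clasp n 0 * S.capNest n n * S.clasp n n *
      (S.twists n b as * S.planarState n true n) =
      S.capNest n 0 * S.clasp n 0 * S.capNest n n * (S.twists n b as * S.planarState n true n) := by
    refine mul_clasp_mul fun T hT i h₁ h₂ => ?_
    have hs : S.e i * S.planarState n true n = S.e (2 * n - 2 - i) * S.planarState n true n := by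
      have := S.e_mul_planarBase (i := i) (i' := 2 * n - 2 - i) (K := n) (n := n) true le_rfl
        (by simpa [twistPos] using h₁) (by simpa [twistPos] using h₂)
        (by simp only [twistPos, if_true]; omega)
      simpa [planarState, nest] using this
    have hF : S.capNest n 0 * S.clasp n 0 * S.capNest n n * S.e (2 * n - 2 - i) = 0 := by
      rw [mul_assoc, S.capNest_mul_e_of_le n (by omega), ← mul_assoc,
        capNest_mul_clasp_mul_e hS (by unfold InnerPair; omega), zero_mul]
    rw [← mul_assoc (S.e i), ← (commute_twists_e hS n as ha b (i := i)
      (by unfold InnerPair; omega)).eq, mul_assoc _ (S.e i), hs, ← mul_assoc _ (S.e _),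
      (commute_twists_e hS n as ha b (by unfold InnerPair; omega)).eq, ← mul_assoc, ← mul_assoc,
      mul_assoc _ T, (hT _ (.inl (by omega))).eq, ← mul_assoc, hF, zero_mul, zero_mul, zero_mul]
  simp only [closing, twistPos, if_true, mul_assoc] at h ⊢
  exact h.symm

end CupCap

/-! ### Arc systems with infinitely many end points -/

/-- A perfect matching of the natural numbers, recorded by the map sending a number to the one
it is matched with. Planarity plays no role. -/
@[ext]
structure InfMatching where
  partner : ℕ → ℕ
  partner_ne : ∀ j, partner j ≠ j
  partner_partner : ∀ j, partner (partner j) = j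

namespace InfMatching

/-- Insert an arc `⊂` at the positions `i`, `i + 1`. -/
def cup (w : InfMatching) (i : ℕ) : InfMatching where
  partner := cupPartner i w.partner
  partner_ne := by
    intro j
    have := w.partner_ne (down i j)
    grind [cupPartner, up, down]
  partner_partner := by
    intro j
    have := w.partner_partner (down i j)
    have := down_up i (w.partner (down i j))
    have := up_down i j
    grind [cupPartner, up]

/-- Join the numbers `i`, `i + 1` by an arc `⊃`; a loop that arises is dropped. -/
def cap (w : InfMatching) (i : ℕ) : InfMatching where
  partner := capPartner i w.partner
  partner_ne := by
    intro j
    have := w.partner_ne (up i j)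
    have := w.partner_partner (up i j)
    have := w.partner_partner i
    have := w.partner_partner (i + 1)
    have := w.partner_ne i
    have := w.partner_ne (i + 1)
    grind [capPartner, up, down]
  partner_partner := by
    intro j
    have := w.partner_partner (up i j)
    have := w.partner_partner i
    have := w.partner_partner (i + 1)
    have := w.partner_ne i
    have := w.partner_ne (i + 1)
    have := down_up i j
    have := up_down i (w.partner (up i j))
    have := up_down i (w.partner i)
    have := up_down i (w.partner (i + 1))
    have : up i j ≠ i ∧ up i j ≠ i + 1 := by grind [up]
    grind [capPartner]

/-- The factor of a loop if joining `i`, `i + 1` closes up a loop, and `1` otherwise. -/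
def loopFactor (w : InfMatching) (i : ℕ) : K := if w.partner i = i + 1 then -qInt 2 else 1

variable (w : InfMatching)

lemma cap_cup_self (i : ℕ) : (w.cup i).cap i = w := by
  ext j
  simp only [cap, cup]
  grind [capPartner, cupPartner, up, down]

lemma cap_cup_succ (i : ℕ) : (w.cup (i + 1)).cap i = w := by
  ext j
  have := w.partner_ne i
  have := w.partner_ne j
  have := w.partner_partner j
  have := w.partner_partner i
  simp only [cap, cup]
  grind [capPartner, cupPartner, up, down]

lemma cap_succ_cup (i : ℕ) : (w.cup i).cap (i + 1) = w := by
  ext j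
  have := w.partner_ne i
  have := w.partner_ne j
  have := w.partner_partner j
  have := w.partner_partner i
  simp only [cap, cup]
  grind [capPartner, cupPartner, up, down]

omit w in
lemma up_injective (i : ℕ) : Function.Injective (up i) :=
  Function.LeftInverse.injective (down_up i)

omit w in
lemma up_up {i j : ℕ} (h : i ≤ j) (x : ℕ) : up (j + 2) (up i x) = up i (up j x) := by
  grind [up]

omit w in
lemma eq_or_eq_or_eq_up (i y : ℕ) : y = i ∨ y = i + 1 ∨ ∃ x, y = up i x := by
  by_cases h : y = i
  · exact .inl h
  by_cases h' : y = i + 1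
  · exact .inr (.inl h')
  exact .inr (.inr ⟨down i y, (up_down i y h h').symm⟩)

lemma cup_partner_self (i : ℕ) : (w.cup i).partner i = i + 1 := by simp [cup, cupPartner]

lemma cup_partner_succ (i : ℕ) : (w.cup i).partner (i + 1) = i := by simp [cup, cupPartner]

lemma cup_partner_up (i x : ℕ) : (w.cup i).partner (up i x) = up i (w.partner x) := by
  have h₁ : up i x ≠ i := by grind [up]
  have h₂ : up i x ≠ i + 1 := by grind [up]
  simp [cup, cupPartner, h₁, h₂, down_up]

/-- The partner function after the numbers `i`, `i + 1` have been joined, but not yet removed. -/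
def joined (i : ℕ) (p : ℕ → ℕ) (y : ℕ) : ℕ :=
  if p y = i then p (i + 1) else if p y = i + 1 then p i else p y

lemma up_cap_partner (i x : ℕ) :
    up i ((w.cap i).partner x) = joined i w.partner (up i x) := by
  have h₁ := w.partner_ne i
  have h₂ := w.partner_ne (i + 1)
  have h₃ := w.partner_partner i
  have h₄ := w.partner_partner (i + 1)
  have h₅ := w.partner_partner (up i x)
  have h₆ : up i x ≠ i := by grind [up]
  have h₇ : up i x ≠ i + 1 := by grind [up]
  refine up_down i _ ?_ ?_ <;> grind

lemma cup_cup {i j : ℕ} (h : i ≤ j) : (w.cup i).cup (j + 2) = (w.cup j).cup i := by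
  have u₁ : up (j + 2) i = i := by grind [up]
  have u₂ : up (j + 2) (i + 1) = i + 1 := by grind [up]
  have u₃ : up i j = j + 2 := by grind [up]
  have u₄ : up i (j + 1) = j + 3 := by grind [up]
  ext y
  rcases eq_or_eq_or_eq_up i y with rfl | rfl | ⟨z, rfl⟩
  · have := (w.cup y).cup_partner_up (j + 2) y
    rw [u₁, cup_partner_self, u₂] at this
    rw [this, cup_partner_self]
  · have := (w.cup i).cup_partner_up (j + 2) (i + 1)
    rw [u₂, cup_partner_succ, u₁] at this
    rw [this, cup_partner_succ]
  rw [cup_partner_up]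
  rcases eq_or_eq_or_eq_up j z with rfl | rfl | ⟨x, rfl⟩
  · rw [cup_partner_self, u₃, u₄, cup_partner_self]
  · rw [cup_partner_succ, u₃, u₄, cup_partner_succ]
  · rw [← up_up h, cup_partner_up, cup_partner_up, cup_partner_up, up_up h]

omit w in
lemma joined_of_comp_up {i i' j : ℕ} {p q : ℕ → ℕ} (hp : ∀ x, q (up j x) = up j (p x))
    (h₁ : up j i = i') (h₂ : up j (i + 1) = i' + 1) (x : ℕ) :
    joined i' q (up j x) = up j (joined i p x) := by
  have e₁ : up j (p x) = i' ↔ p x = i := by rw [← h₁, (up_injective j).eq_iff]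
  have e₂ : up j (p x) = i' + 1 ↔ p x = i + 1 := by rw [← h₂, (up_injective j).eq_iff]
  have e₃ : q i' = up j (p i) := by rw [← h₁, hp]
  have e₄ : q (i' + 1) = up j (p (i + 1)) := by rw [← h₂, hp]
  simp only [joined, hp, e₁, e₂, e₃, e₄]
  split_ifs <;> rfl

lemma cap_cup_of_le {i j : ℕ} (h : i ≤ j) : (w.cup i).cap (j + 2) = (w.cap j).cup i := by
  have u₁ : up (j + 2) i = i := by grind [up]
  have u₂ : up (j + 2) (i + 1) = i + 1 := by grind [up]
  have u₃ : up i j = j + 2 := by grind [up]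
  have u₄ : up i (j + 1) = j + 2 + 1 := by grind [up]
  ext y
  apply up_injective (j + 2)
  rw [up_cap_partner]
  rcases eq_or_eq_or_eq_up i y with rfl | rfl | ⟨x, rfl⟩
  · rw [u₁, cup_partner_self, u₂, joined, cup_partner_self, if_neg (by omega), if_neg (by omega)]
  · rw [u₂, cup_partner_succ, u₁, joined, cup_partner_succ, if_neg (by omega), if_neg (by omega)]
  · rw [up_up h, joined_of_comp_up (w.cup_partner_up i) u₃ u₄, cup_partner_up, up_up h,
      up_cap_partner]

lemma cap_cup_of_ge {i j : ℕ} (h : i ≤ j) : (w.cup (j + 2)).cap i = (w.cap i).cup j := by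
  have u₁ : up (j + 2) i = i := by grind [up]
  have u₂ : up (j + 2) (i + 1) = i + 1 := by grind [up]
  have u₃ : up i j = j + 2 := by grind [up]
  have u₄ : up i (j + 1) = j + 2 + 1 := by grind [up]
  ext y
  apply up_injective i
  rw [up_cap_partner]
  rcases eq_or_eq_or_eq_up j y with rfl | rfl | ⟨x, rfl⟩
  · rw [u₃, cup_partner_self, u₄, joined, cup_partner_self, if_neg (by omega), if_neg (by omega)]
  · rw [u₄, cup_partner_succ, u₃, joined, cup_partner_succ, if_neg (by omega), if_neg (by omega)]
  · rw [← up_up h, joined_of_comp_up (w.cup_partner_up (j + 2)) u₁ u₂, cup_partner_up, ← up_up h,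
      up_cap_partner]

/-- Joining two numbers after `j`, `j + 1` have been joined and removed amounts to joining the
corresponding numbers before the removal. -/
lemma up_joined_cap {i i' j : ℕ} (h₁ : up j i = i') (h₂ : up j (i + 1) = i' + 1) (x : ℕ) :
    up j (joined i (w.cap j).partner x) = joined i' (joined j w.partner) (up j x) :=
  (joined_of_comp_up (fun x => (w.up_cap_partner j x).symm) h₁ h₂ x).symm

lemma joined_joined {i k y : ℕ} (h : i + 2 ≤ k) (h₁ : y ≠ i) (h₂ : y ≠ i + 1) (h₃ : y ≠ k)
    (h₄ : y ≠ k + 1) :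
    joined i (joined k w.partner) y = joined k (joined i w.partner) y := by
  have := w.partner_partner i
  have := w.partner_partner (i + 1)
  have := w.partner_partner k
  have := w.partner_partner (k + 1)
  have := w.partner_partner y
  have := w.partner_ne i
  have := w.partner_ne (i + 1)
  have := w.partner_ne k
  have := w.partner_ne (k + 1)
  grind [joined]

lemma cap_cap {i j : ℕ} (h : i ≤ j) : (w.cap (j + 2)).cap i = (w.cap i).cap j := by
  have u₁ : up (j + 2) i = i := by grind [up]
  have u₂ : up (j + 2) (i + 1) = i + 1 := by grind [up]
  have u₃ : up i j = j + 2 := by grind [up]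
  have u₄ : up i (j + 1) = j + 2 + 1 := by grind [up]
  ext x
  apply up_injective i
  apply up_injective (j + 2)
  rw [up_cap_partner, up_joined_cap _ u₁ u₂, up_up h, up_up h, up_cap_partner,
    up_joined_cap _ u₃ u₄]
  apply joined_joined <;> grind [up]

/-- The number of loops that two arcs `⊃` close up does not depend on their order. -/
lemma loopFactor_mul_loopFactor {i j : ℕ} (h : i ≤ j) :
    w.loopFactor (j + 2) * (w.cap (j + 2)).loopFactor i =
      w.loopFactor i * (w.cap i).loopFactor j := by
  have u₁ : up (j + 2) i = i := by grind [up]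
  have u₂ : up (j + 2) (i + 1) = i + 1 := by grind [up]
  have u₃ : up i j = j + 2 := by grind [up]
  have u₄ : up i (j + 1) = j + 3 := by grind [up]
  have e₁ : (w.cap (j + 2)).partner i = i + 1 ↔ joined (j + 2) w.partner i = i + 1 := by
    rw [← (up_injective (j + 2)).eq_iff, up_cap_partner, u₁, u₂]
  have e₂ : (w.cap i).partner j = j + 1 ↔ joined i w.partner (j + 2) = j + 3 := by
    rw [← (up_injective i).eq_iff, up_cap_partner, u₃, u₄]
  have key : (w.partner (j + 2) = j + 3 ∧ joined (j + 2) w.partner i = i + 1 ↔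
      w.partner i = i + 1 ∧ joined i w.partner (j + 2) = j + 3) ∧
      (w.partner (j + 2) = j + 3 ∨ joined (j + 2) w.partner i = i + 1 ↔
      w.partner i = i + 1 ∨ joined i w.partner (j + 2) = j + 3) := by
    have := w.partner_partner i
    have := w.partner_partner (i + 1)
    have := w.partner_partner (j + 2)
    have := w.partner_partner (j + 3)
    have := w.partner_ne i
    have := w.partner_ne (i + 1)
    have := w.partner_ne (j + 2)
    have := w.partner_ne (j + 3)
    constructor <;> grind [joined]
  simp only [loopFactor, e₁, e₂]
  split_ifs <;> first | rfl | exact mul_comm _ _ | (exfalso; tauto)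

lemma loopFactor_cup_self (i : ℕ) : (w.cup i).loopFactor i = -qInt 2 := by
  simp [loopFactor, cup, cupPartner]

lemma loopFactor_cup_succ (i : ℕ) : (w.cup (i + 1)).loopFactor i = 1 := by
  simp only [loopFactor, cup]
  grind [cupPartner, up, down]

lemma loopFactor_succ_cup (i : ℕ) : (w.cup i).loopFactor (i + 1) = 1 := by
  simp only [loopFactor, cup]
  grind [cupPartner, up, down]

lemma loopFactor_cup_of_le {i j : ℕ} (h : i ≤ j) :
    (w.cup i).loopFactor (j + 2) = w.loopFactor j := by
  simp only [loopFactor, cup]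
  grind [cupPartner, up, down]

lemma loopFactor_cup_of_ge {i j : ℕ} (h : i ≤ j) :
    (w.cup (j + 2)).loopFactor i = w.loopFactor i := by
  simp only [loopFactor, cup]
  grind [cupPartner, up, down]

end InfMatching

/-- The vector space spanned by the perfect matchings of the natural numbers. -/
abbrev InfW : Type := InfMatching →₀ K

/-- Arcs `⊂` and `⊃` acting on matchings of the natural numbers. A loop is worth `-[2]`. -/
def infCupCap : CupCap K (Module.End K InfW) where
  loop := -qInt 2
  U i := Finsupp.lsum K fun w => Finsupp.lsingle (w.cup i)
  D i := Finsupp.lsum K fun w => w.loopFactor i • Finsupp.lsingle (w.cap i)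
  D_U_self i := by
    ext w : 2
    simp [w.cap_cup_self, w.loopFactor_cup_self]
  D_U_succ i := by
    ext w : 2
    simp [w.cap_cup_succ, w.loopFactor_cup_succ]
  D_succ_U i := by
    ext w : 2
    simp [w.cap_succ_cup, w.loopFactor_succ_cup]
  U_U i j h := by
    ext w : 2
    simp [w.cup_cup h]
  D_D i j h := by
    ext w : 2
    simp [w.cap_cap h, w.loopFactor_mul_loopFactor h, mul_comm]
  D_U_of_le i j h := by
    ext w : 2
    simp [w.cap_cup_of_le h, w.loopFactor_cup_of_le h]
  D_U_of_ge i j h := by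
    ext w : 2
    simp [w.cap_cup_of_ge h, w.loopFactor_cup_of_ge h]

lemma infCupCap_U_single (i : ℕ) (w : InfMatching) (x : K) :
    infCupCap.U i (Finsupp.single w x) = Finsupp.single (w.cup i) x := by
  simp [infCupCap]

lemma infCupCap_D_single (i : ℕ) (w : InfMatching) (x : K) :
    infCupCap.D i (Finsupp.single w x) = Finsupp.single (w.cap i) (w.loopFactor i * x) := by
  simp [infCupCap]

/-! ### Padding of webs -/

/-- A basis web with arcs `⊂` appended below all end points. -/
def BasisWeb.pad (w : BasisWeb) : InfMatching where
  partner j := if j < w.ends then w.partner j else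
    if (j - w.ends) % 2 = 0 then j + 1 else j - 1
  partner_ne := by
    intro j
    have := w.partner_ne j
    grind
  partner_partner := by
    intro j
    have := w.partner_partner j
    have := w.partner_lt j
    grind

lemma BasisWeb.pad_cup (w : BasisWeb) {i : ℕ} (hi : i ≤ w.ends) :
    (w.cup i hi).pad = w.pad.cup i := by
  ext j
  have := w.partner_lt (down i j)
  simp only [pad, BasisWeb.cup, InfMatching.cup]
  grind [cupPartner, up, down]

lemma BasisWeb.pad_cap (w : BasisWeb) {i : ℕ} (hi : i + 2 ≤ w.ends) :
    (w.cap i hi).pad = w.pad.cap i := by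
  ext j
  have := w.partner_lt (up i j)
  have := w.partner_lt i
  have := w.partner_lt (i + 1)
  have := w.partner_partner (up i j)
  have := w.partner_partner i
  have := w.partner_partner (i + 1)
  have := w.partner_ne i
  have := w.partner_ne (i + 1)
  simp only [pad, BasisWeb.cap, InfMatching.cap]
  grind [capPartner, up, down]

lemma BasisWeb.loopFactor_pad (w : BasisWeb) {i : ℕ} (hi : i + 2 ≤ w.ends) :
    w.pad.loopFactor i = if w.partner i = i + 1 then -qInt 2 else 1 := by
  have : i < w.ends := by omega
  simp [InfMatching.loopFactor, pad, this]

/-- The linear extension of the padding of webs. -/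
def padding : W →ₗ[K] InfW := Finsupp.lmapDomain K K BasisWeb.pad

/-- The web space `W_m`. -/
def webSpace (m : ℕ) : Submodule K W := Finsupp.supported K K {w | w.ends = m}

/-- The operator `f` maps `W_m` to `W_m'`, and there padding carries it to `T`. -/
def Intertwines (m m' : ℕ) (f : W →ₗ[K] W) (T : Module.End K InfW) : Prop :=
  ∀ x ∈ webSpace m, f x ∈ webSpace m' ∧ padding (f x) = T (padding x)

namespace Intertwines

variable {m m' m'' : ℕ} {f f' : W →ₗ[K] W} {T T' : Module.End K InfW}

lemma of_single (h : ∀ w : BasisWeb, w.ends = m → f (Finsupp.single w 1) ∈ webSpace m' ∧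
    padding (f (Finsupp.single w 1)) = T (Finsupp.single w.pad 1)) : Intertwines m m' f T := by
  intro x hx
  rw [webSpace, Finsupp.supported_eq_span_single] at hx
  induction hx using Submodule.span_induction with
  | mem x hx =>
    obtain ⟨w, hw, rfl⟩ := hx
    refine ⟨(h w hw).1, (h w hw).2.trans ?_⟩
    simp [padding]
  | zero => simp
  | add x y _ _ hx hy =>
    simp only [map_add, hx.2, hy.2, and_true]
    exact add_mem hx.1 hy.1
  | smul c x _ hx =>
    simp only [map_smul, hx.2, and_true]
    exact Submodule.smul_mem _ _ hx.1

lemma id : Intertwines m m LinearMap.id 1 := fun _ hx => ⟨hx, rfl⟩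

lemma comp (h' : Intertwines m' m'' f' T') (h : Intertwines m m' f T) :
    Intertwines m m'' (f' ∘ₗ f) (T' * T) := by
  intro x hx
  obtain ⟨h₁, h₂⟩ := h x hx
  obtain ⟨h₃, h₄⟩ := h' _ h₁
  exact ⟨h₃, by rw [LinearMap.comp_apply, h₄, h₂]; rfl⟩

lemma add (h : Intertwines m m' f T) (h' : Intertwines m m' f' T') :
    Intertwines m m' (f + f') (T + T') := by
  intro x hx
  exact ⟨add_mem (h x hx).1 (h' x hx).1, by simp [(h x hx).2, (h' x hx).2]⟩

lemma smul (c : K) (h : Intertwines m m' f T) : Intertwines m m' (c • f) (c • T) := by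
  intro x hx
  exact ⟨Submodule.smul_mem _ _ (h x hx).1, by simp [(h x hx).2]⟩

lemma cup {i : ℕ} (hi : i ≤ m) : Intertwines m (m + 2) (cupOp i) (infCupCap.U i) := by
  refine of_single fun w hw => ?_
  subst hw
  have : cupOp i (Finsupp.single w 1) = Finsupp.single (w.cup i hi) 1 := by
    simp [cupOp, hi]
  rw [this, infCupCap_U_single, ← w.pad_cup hi]
  refine ⟨Finsupp.single_mem_supported _ _ rfl, ?_⟩
  simp [padding]

lemma cap {i : ℕ} (hi : i ≤ m) : Intertwines (m + 2) m (capOp i) (infCupCap.D i) := by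
  refine of_single fun w hw => ?_
  have hi' : i + 2 ≤ w.ends := by omega
  have : capOp i (Finsupp.single w 1) = Finsupp.single (w.cap i hi')
      (if w.partner i = i + 1 then -qInt 2 else 1) := by
    simp [capOp, hi']
  rw [this, infCupCap_D_single, ← w.pad_cap hi', w.loopFactor_pad hi', mul_one]
  refine ⟨Finsupp.single_mem_supported _ _ ?_, ?_⟩
  · simp [BasisWeb.cap, hw]
  · simp [padding]

lemma hook {i : ℕ} (hi : i + 2 ≤ m) : Intertwines m m (hookOp i) (infCupCap.e i) := by
  obtain ⟨m, rfl⟩ : ∃ m', m = m' + 2 := ⟨m - 2, by omega⟩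
  exact (cup (by omega)).comp (cap (by omega))

lemma cross (right : Bool) {i : ℕ} (hi : i + 2 ≤ m) :
    Intertwines m m (crossOp right i) (infCupCap.g (if right then q4 else q4⁻¹) i) := by
  have h : ∀ x : K, Intertwines m m (x • LinearMap.id + x⁻¹ • hookOp i) (infCupCap.g x i) :=
    fun x => (id.smul x).add ((hook hi).smul x⁻¹)
  cases right
  · have := h q4⁻¹
    rwa [inv_inv] at this
  · exact h q4

lemma clasp {n i : ℕ} (h : i + n ≤ m) :
    Intertwines m m (claspOp n i) (infCupCap.clasp n i) := by
  induction n using Nat.strong_induction_on with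
  | _ n ih =>
    match n with
    | 0 => exact id
    | 1 => exact id
    | n + 2 =>
      have h₁ := ih (n + 1) (by omega) (by omega)
      have h₂ := h₁.comp ((hook (i := i + n) (by omega)).comp h₁)
      rw [← mul_assoc] at h₂
      rw [claspOp, CupCap.clasp]
      exact h₁.add (h₂.smul _)

end Intertwines

/-! ### Diagrams as operators -/

/-- The operator that glues the pieces of a list. -/
def piecesOp (L : List Piece) : W →ₗ[K] W := L.foldl (fun f P => P.op ∘ₗ f) LinearMap.id

lemma piecesOp_append (L L' : List Piece) :
    piecesOp (L ++ L') = piecesOp L' ∘ₗ piecesOp L := by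
  have : ∀ f : W →ₗ[K] W, L'.foldl (fun f P => P.op ∘ₗ f) f = piecesOp L' ∘ₗ f := by
    induction L' using List.reverseRecOn with
    | nil => intro f; rfl
    | append_singleton L' P ih =>
      intro f
      simp only [piecesOp, List.foldl_append, List.foldl_cons, List.foldl_nil]
      rw [ih, LinearMap.comp_assoc]
      rfl
  rw [piecesOp, List.foldl_append, this]
  rfl

lemma bracket_eq (L : List Piece) : bracket L = piecesOp L (Finsupp.single BasisWeb.empty 1) := by
  induction L using List.reverseRecOn with
  | nil => rfl
  | append_singleton L P ih =>
    rw [piecesOp_append, LinearMap.comp_apply, ← ih, bracket, bracket, List.foldl_append]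
    rfl

namespace Intertwines

lemma cupCable {m p : ℕ} (n : ℕ) (hp : p ≤ m) :
    Intertwines m (m + 2 * n) (piecesOp (cupCable n p)) (infCupCap.nest n p) := by
  induction n with
  | zero => exact id
  | succ n ih =>
    have : ColoredJones.cupCable (n + 1) p = ColoredJones.cupCable n p ++ [.cup (p + n)] := by
      simp [ColoredJones.cupCable, List.range_succ]
    rw [this, piecesOp_append]
    exact (cup (m := m + 2 * n) (i := p + n) (by omega)).comp ih

lemma capCable {m p : ℕ} (n : ℕ) (hp : p ≤ m) :
    Intertwines (m + 2 * n) m (piecesOp (capCable n p)) (infCupCap.capNest n p) := by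
  induction n with
  | zero => exact id
  | succ n ih =>
    have : ColoredJones.capCable (n + 1) p = [.cap (p + n)] ++ ColoredJones.capCable n p := by
      simp [ColoredJones.capCable, List.range_succ]
    rw [this, piecesOp_append]
    exact ih.comp (cap (m := m + 2 * n) (i := p + n) (by omega))

lemma crossCable (right : Bool) {m p : ℕ} (n : ℕ) (hp : p + 2 * n ≤ m) :
    Intertwines m m (piecesOp (crossCable right n p))
      (infCupCap.bundleCross (if right then q4 else q4⁻¹) n n p) := by
  have row : ∀ N q, q + N + 1 ≤ m →
      Intertwines m m (piecesOp ((List.range N).map fun b => .cross right (q + b)))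
        (infCupCap.row (if right then q4 else q4⁻¹) N q) := by
    intro N q hq
    induction N with
    | zero => exact id
    | succ N ih =>
      rw [List.range_succ, List.map_append, piecesOp_append]
      exact (cross right (m := m) (i := q + N) (by omega)).comp (ih (by omega))
  have main : ∀ M, p + M + n ≤ m →
      Intertwines m m (piecesOp ((List.range M).reverse.flatMap fun a =>
        (List.range n).map fun b => .cross right (p + a + b)))
        (infCupCap.bundleCross (if right then q4 else q4⁻¹) M n p) := by
    intro M hM
    induction M with
    | zero => exact id
    | succ M ih =>
      rw [List.range_succ, List.reverse_append, List.flatMap_append, piecesOp_append,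
        infCupCap.bundleCross_succ_row]
      refine (ih (by omega)).comp ?_
      simpa using row n (p + M) (by omega)
  exact main n (by omega)

lemma piece_clasp {m n i : ℕ} (h : i + n ≤ m) :
    Intertwines m m (piecesOp [.clasp n i]) (infCupCap.clasp n i) :=
  clasp h

/-- The scalar of a closed diagram can be computed with matchings. -/
lemma closedBracket_eq {L : List Piece} {c : K}
    (h : Intertwines 0 0 (piecesOp L) (c • (1 : Module.End K InfW))) : closedBracket L = c := by
  obtain ⟨h₁, h₂⟩ := h (Finsupp.single BasisWeb.empty 1)
    (Finsupp.single_mem_supported _ _ rfl)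
  rw [← bracket_eq] at h₁ h₂
  have hb : bracket L = Finsupp.single BasisWeb.empty (closedBracket L) := by
    ext w
    by_cases hw : w.ends = 0
    · have hw' : w = BasisWeb.empty := by
        ext j
        · exact hw
        · exact w.partner_of_ge j (by omega)
      rw [hw', Finsupp.single_eq_same]
      rfl
    · rw [Finsupp.single_eq_of_ne (by rintro rfl; exact hw rfl)]
      by_contra h0
      exact hw (h₁ (Finsupp.mem_support_iff.2 h0))
  rw [hb] at h₂
  have h₃ := congrArg (fun v : InfW => v BasisWeb.empty.pad) h₂
  simpa [padding] using h₃

end Intertwines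

/-! ### Two-bridge diagrams -/

/-- The operator `T` describes the `n`-parallel of a tangle diagram. -/
def Describes (n : ℕ) {s : List Bool} (D : Tangle s) (T : Module.End K InfW) : Prop :=
  Intertwines 0 (n * s.length) (piecesOp (D.colored n)) T

lemma swapPartner_swapPartner (i : ℕ) (p : ℕ → ℕ) : swapPartner i (swapPartner i p) = p := by
  funext j
  simp [swapPartner]

/-- The connections of the end points of a diagram with four end points of which the two upper and
the two lower ones are joined. -/
def bridgeConn : ℕ → ℕ := cupPartner 2 (cupPartner 0 id)

lemma fullTwists_conn (right : Bool) (l₁ l₂ : List Bool) (b c : Bool) (k : ℕ)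
    (D : Tangle (l₁ ++ b :: c :: l₂)) : (Tangle.fullTwists right l₁ l₂ b c k D).conn = D.conn := by
  induction k with
  | zero => rfl
  | succ k ih =>
    rw [Tangle.fullTwists, Tangle.conn, Tangle.conn, swapPartner_swapPartner, ih]

lemma fullTwists_writhe (right : Bool) (l₁ l₂ : List Bool) (b : Bool) (k : ℕ)
    (D : Tangle (l₁ ++ b :: (!b) :: l₂)) :
    (Tangle.fullTwists right l₁ l₂ b (!b) k D).writhe =
      D.writhe + 2 * k * (if right then -1 else 1) := by
  induction k with
  | zero => simp [Tangle.fullTwists]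
  | succ k ih =>
    rw [Tangle.fullTwists, Tangle.writhe, Tangle.writhe, ih]
    cases b <;> cases right <;> simp <;> ring

lemma box_writhe (a : ℤ) (l₁ l₂ : List Bool) (b : Bool) (D : Tangle (l₁ ++ b :: (!b) :: l₂)) :
    (Tangle.box a l₁ l₂ b (!b) D).writhe = D.writhe - 2 * a := by
  rw [Tangle.box, fullTwists_writhe]
  rcases lt_trichotomy a 0 with h | rfl | h
  · simp [h.not_gt, abs_of_neg h]; ring
  · simp
  · simp [h, abs_of_pos h]; ring

lemma bridge_writhe (b : Bool) (as : List ℤ) (D : Tangle [false, true, false, true]) :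
    (Tangle.bridge b as D).writhe = D.writhe - 2 * as.sum := by
  induction as generalizing b D with
  | nil => cases b <;> simp [Tangle.bridge, Tangle.writhe]
  | cons a as ih =>
    cases b <;> rw [Tangle.bridge, ih, List.sum_cons]
    · linarith [show (Tangle.box a [false, true] [] false true D).writhe = _ from
        box_writhe a [false, true] [] false D]
    · linarith [show (Tangle.box a [false] [true] true false D).writhe = _ from
        box_writhe a [false] [true] true D]

lemma Describes.fullTwists {n : ℕ} (right : Bool) (l₁ l₂ : List Bool) (b c : Bool) (k : ℕ)
    {D : Tangle (l₁ ++ b :: c :: l₂)} {T : Module.End K InfW} (h : Describes n D T) :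
    Describes n (Tangle.fullTwists right l₁ l₂ b c k D)
      ((infCupCap.bundleCross (if right then q4 else q4⁻¹) n n (n * l₁.length)) ^ (2 * k) * T) := by
  have hlen : ∀ b c : Bool,
      n * (l₁ ++ b :: c :: l₂).length = n * l₁.length + 2 * n + n * l₂.length :=
    fun b c => by simp only [List.length_append, List.length_cons]; ring
  induction k with
  | zero => simpa [Tangle.fullTwists] using h
  | succ k ih =>
    unfold Describes at ih ⊢
    rw [hlen] at ih ⊢
    have hX := Intertwines.crossCable right (m := n * l₁.length + 2 * n + n * l₂.length)
      (p := n * l₁.length) n (by omega)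
    rw [Tangle.fullTwists, Tangle.colored, Tangle.colored, piecesOp_append, piecesOp_append,
      show 2 * (k + 1) = 2 * k + 1 + 1 by ring, pow_succ', pow_succ', mul_assoc, mul_assoc]
    exact hX.comp (hX.comp ih)

lemma Describes.box {n : ℕ} {a : ℤ} (ha : a ≠ 0) (l₁ l₂ : List Bool) (b c : Bool)
    {D : Tangle (l₁ ++ b :: c :: l₂)} {T : Module.End K InfW} (h : Describes n D T) :
    Describes n (Tangle.box a l₁ l₂ b c D)
      ((infCupCap.bundleCross (q4 ^ a.sign) n n (n * l₁.length)) ^ (2 * a.natAbs) * T) := by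
  have := h.fullTwists (decide (0 < a)) l₁ l₂ b c a.natAbs
  rcases lt_or_gt_of_ne ha with h' | h'
  · simpa [Int.sign_eq_neg_one_of_neg h', h'.not_gt, Tangle.box] using this
  · simpa [Int.sign_eq_one_of_pos h', h', Tangle.box] using this

/-- The closing of a 2-bridge diagram, with a clasp in each component: if the middle bundles are
joined, the diagram is a knot and has a single clasp. -/
def bridgeClosing (n : ℕ) : Bool → Module.End K InfW
  | true => infCupCap.capNest n 0 * infCupCap.clasp n 0 * infCupCap.capNest n n
  | false => infCupCap.closing n false

lemma Describes.bridge {n : ℕ} (as : List ℤ) (ha : ∀ x ∈ as, x ≠ 0) (b : Bool)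
    {D : Tangle [false, true, false, true]} (hD : D.conn = bridgeConn) {T : Module.End K InfW}
    (h : Describes n D T) :
    Describes n (Tangle.bridge b as D)
      (bridgeClosing n (CupCap.endFlag b as) * infCupCap.twists n b as * T) := by
  induction as generalizing b D T with
  | nil =>
    have h' : Intertwines 0 (0 + 2 * n + 2 * n) (piecesOp (D.colored n)) T := by
      have := h
      unfold Describes at this
      rwa [show n * [false, true, false, true].length = 0 + 2 * n + 2 * n by simp; ring] at this
    have hclasp : ∀ {m i : ℕ}, i + n ≤ m → _ := fun h => Intertwines.piece_clasp h
    simp only [CupCap.endFlag, CupCap.twists, mul_one]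
    unfold Describes
    cases b
    · have e₁ : bridgeConn 2 = 3 := rfl
      have e₂ : capPartner 2 bridgeConn 0 = 1 := rfl
      simp only [Tangle.bridge, Tangle.colored, Tangle.conn, List.length_cons, List.length_nil, hD,
        zero_add, mul_zero, Nat.reduceAdd, e₁, e₂, if_true]
      rw [piecesOp_append, piecesOp_append, piecesOp_append, piecesOp_append, bridgeClosing,
        CupCap.closing, CupCap.twistPos, if_neg (by simp), mul_comm n 2]
      simp only [mul_assoc]
      exact (Intertwines.capCable n (Nat.zero_le _)).comp ((hclasp (by omega)).comp
        ((Intertwines.capCable n (by omega)).comp ((hclasp (by omega)).comp h')))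
    · have e₁ : bridgeConn 1 ≠ 2 := by decide
      have e₂ : capPartner 1 bridgeConn 0 = 1 := rfl
      simp only [Tangle.bridge, Tangle.colored, Tangle.conn, List.length_cons, List.length_nil, hD,
        zero_add, mul_zero, Nat.reduceAdd, e₁, e₂, if_true, if_false, List.append_nil, mul_one]
      rw [piecesOp_append, piecesOp_append, piecesOp_append, bridgeClosing]
      simp only [mul_assoc]
      exact (Intertwines.capCable n (Nat.zero_le _)).comp ((hclasp (by omega)).comp
        ((Intertwines.capCable n (by omega)).comp h'))
  | cons a as ih =>
    have ha' : a ≠ 0 := ha a List.mem_cons_self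
    have has : ∀ x ∈ as, x ≠ 0 := fun x hx => ha x (List.mem_cons_of_mem _ hx)
    cases b
    · have := ih has true (D := Tangle.box a [false, true] [] false true D)
        ((fullTwists_conn _ [false, true] [] false true _ D).trans hD)
        (Describes.box ha' [false, true] [] false true h)
      simpa [CupCap.endFlag, CupCap.twists, CupCap.twistPos, Tangle.bridge, mul_assoc, mul_comm n 2]
        using this
    · have := ih has false (D := Tangle.box a [false] [true] true false D)
        ((fullTwists_conn _ [false] [true] true false _ D).trans hD)
        (Describes.box ha' [false] [true] true false h)
      simpa [CupCap.endFlag, CupCap.twists, CupCap.twistPos, Tangle.bridge, mul_assoc] using this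

lemma describes_bridgeStart (n : ℕ) :
    Describes n bridgeStart (infCupCap.planarState n true n) := by
  have h₁ := Intertwines.cupCable (m := 0) (p := 0) n le_rfl
  have h₂ := Intertwines.cupCable (m := 0 + 2 * n) (p := 2 * n) n (by omega)
  have h := h₂.comp h₁
  rw [← piecesOp_append] at h
  have hT : infCupCap.planarState n true n = infCupCap.nest n (2 * n) * infCupCap.nest n 0 := by
    simp [CupCap.planarState, CupCap.planarBase, CupCap.nest, two_mul]
  rw [hT]
  unfold Describes
  simpa [bridgeStart, Tangle.colored, mul_comm n 2, show n * 4 = 2 * n + 2 * n by ring] using h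

lemma closedBracket_coloredCircle (n : ℕ) :
    closedBracket (coloredCircle n) = (-1) ^ n * qInt (n + 1) := by
  apply Intertwines.closedBracket_eq
  rw [← CupCap.circle_eq (S := infCupCap) rfl, coloredCircle, piecesOp_append, piecesOp_append,
    CupCap.circle, mul_assoc]
  exact (Intertwines.capCable n le_rfl).comp ((Intertwines.piece_clasp (by omega)).comp
    (Intertwines.cupCable n le_rfl))

lemma closedBracket_twoBridge (n : ℕ) (a : List ℤ) (ha : ∀ x ∈ a, x ≠ 0) :
    q4 ^ (2 * ((n : ℤ) ^ 2 + 2 * n) * a.sum) * closedBracket ((twoBridge a).colored n) =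
      twistSum n a n * closedBracket (coloredCircle n) := by
  have hS : infCupCap.loop = -qInt 2 := rfl
  have h₁ := (describes_bridgeStart n).bridge a ha true rfl
  have h₂ : bridgeClosing n (CupCap.endFlag true a) * infCupCap.twists n true a *
      infCupCap.planarState n true n = infCupCap.closing n (CupCap.endFlag true a) *
        infCupCap.twists n true a * infCupCap.planarState n true n := by
    cases CupCap.endFlag true a
    · rfl
    · exact CupCap.closing_mul_twists_mul_nest hS n a ha true
  have h₃ := (CupCap.closing_mul_twists_mul_planarState hS n a ha true).2 n le_rfl
  have hq := zpow_ne_zero (2 * ((n : ℤ) ^ 2 + 2 * n) * a.sum) q4_ne_zero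
  rw [CupCap.circle_eq hS, smul_smul] at h₃
  rw [h₂, (eq_inv_smul_iff₀ hq).2 h₃, smul_smul] at h₁
  rw [closedBracket_coloredCircle, twoBridge, Intertwines.closedBracket_eq h₁,
    mul_inv_cancel_left₀ hq]

lemma coloredJones_twoBridge (n : ℕ) (a : List ℤ) (ha : ∀ x ∈ a, x ≠ 0) :
    coloredJones n (twoBridge a) = twistSum n a n := by
  have hw : (twoBridge a).writhe = -(2 * a.sum) := by
    rw [twoBridge, bridge_writhe]
    simp [bridgeStart, Tangle.writhe]
  have hc : closedBracket (coloredCircle n) ≠ 0 := by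
    rw [closedBracket_coloredCircle]
    exact mul_ne_zero (pow_ne_zero _ (by simp)) (qInt_ne_zero (by omega))
  have hf : ((-1) ^ n * q4 ^ (n ^ 2 + 2 * n)) ^ (-(twoBridge a).writhe) =
      q4 ^ (2 * ((n : ℤ) ^ 2 + 2 * n) * a.sum) := by
    have hs : (((-1 : K) ^ n) ^ 2) = 1 := by rw [← pow_mul, mul_comm, pow_mul]; simp
    rw [hw, neg_neg, zpow_mul, zpow_ofNat, mul_pow, hs, one_mul, ← pow_mul, ← zpow_natCast,
      ← zpow_mul]
    congr 1
    push_cast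
    ring
  rw [coloredJones, hf, closedBracket_twoBridge n a ha, mul_div_cancel_right₀ _ hc]

end ColoredJones

end

theorem mainTheorem5 (n : ℕ) (a : List ℤ) (ha : ∀ x ∈ a, x ≠ 0) :
    ColoredJones.coloredJones n (ColoredJones.twoBridge a) = ColoredJones.twistSum n a n :=
  ColoredJones.coloredJones_twoBridge n a ha
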